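/- **Definitions.** Let $m,n\ge 1$ be integers. - *Matrices.* For $N\times N$ complex matrices put $\langle P,Q\rangle=\frac1N\operatorname{Tr}P^\dagger Q$ and $|||P|||_2^2=\langle P,P\rangle$. Let $\mathcal H_m^{\otimes n}$ be the space of Hermitian operators on $(\mathbb C^m)^{\otimes n}$. A *standard orthonormal basis* is a family $\mathcal B_0,\dots,\mathcal B_{m^2-1}$ of Hermitian $m\times m$ matrices, orthonormal for $\langle\cdot,\cdot\rangle$, with $\mathcal B_0=\mathrm{id}_m$. For a multi-index $\sigma$ with entries in $\{0,\dots,m^2-1\}$ let $\mathcal B_\sigma=\bigotimes_i\mathcal B_{\sigma_i}$, and let $|\sigma|$ be the number of nonzero entries of $\sigma$. Each $P\in\mathcal H_m^{\otimes n}$ has the Fourier expansion $P=\sum_\sigma\widehat P(\sigma)\mathcal B_\sigma$ with real coefficients $\widehat P(\sigma)=\langle \mathcal B_\sigma,P\rangle$. Its degree is $\max\{|\sigma|:\widehat P(\sigma)\ne0\}$ (and $0$ if $P=0$). The influence of the $i$-th register is $\mathrm{Inf}_i(P)=|||P-\frac{\mathrm{id}_m}{m}\otimes\operatorname{Tr}_iP|||_2^2$,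 where the identity is placed in register $i$ and $\operatorname{Tr}_i$ is the partial trace over register $i$ (equivalently, $\mathrm{Inf}_i(P)=\sum_{\sigma_i\neq0}\widehat P(\sigma)^2$). - *Ensembles.* A $(k,n)$ ensemble is a sequence $\mathbf x=(\mathbf x_1,\dots,\mathbf x_n)$ of *independent* families $\mathbf x_i=(\mathbf x_{i,0}=1,\mathbf x_{i,1},\dots,\mathbf x_{i,k-1})$ of square-integrable real random variables with $\mathbb E[\mathbf x_{i,j}\mathbf x_{i,l}]=\delta_{j,l}$. It is $(2,4,\eta)$-*hypercontractive* if, for all real coefficients $(\widehat Q(\tau))_{\tau\in\{0,\dots,k-1\}^n}$, one has $\big\|\sum_{\tau}\eta^{|\tau|}\widehat Q(\tau)\prod_i\mathbf x_{i,\tau_i}\big\|_4\le\big\|\sum_\tau\widehat Q(\tau)\prod_i\mathbf x_{i,\tau_i}\big\|_2$. - *The function $\zeta$.* Let $\zeta(x)=x^2$ for $x\le0$ and $\zeta(x)=0$ for $x>0$. It is applied to Hermitian matrices through the spectral decomposition. **Statement.** There are universal constants $C,B_3>0$ such that the following holds. Let $0<\tau,\eta<1$, let $d,h,m,n$ be positive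 integers, let $H\subseteq[n]$ with $|H|=h$, let $\{\mathcal B_i\}_{i=0}^{m^2-1}$ be a standard orthonormal basis of the $m\times m$ matrices, and let $\mathbf x$ be a $(2,4,\eta)$-hypercontractive $(m^2,n)$ ensemble. Let $P\in\mathcal H_m^{\otimes n}$ have degree at most $d$, and suppose that $\mathrm{Inf}_i(P)\le\tau$ for all $i\notin H$ and that $\sum_{\sigma\neq0}\widehat P(\sigma)^2\le1$. Put $$P^H(\mathbf x)=\sum_{\sigma}\widehat P(\sigma)\Big(\prod_{i\notin H}\mathbf x_{i,\sigma_i}\Big)\bigotimes_{i\in H}\mathcal B_{\sigma_i}.$$ Then $\operatorname{Tr}\zeta(P^H(\mathbf x))$ is integrable and $$\Big|m^{-n}\operatorname{Tr}\zeta(P)-m^{-h}\,\mathbb E\operatorname{Tr}\zeta(P^H(\mathbf x))\Big|\le3\Big(C\,B_3\,\max\{9m,1/\eta^4\}^d\,\sqrt\tau\,d\Big)^{2/3}.$$ -/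

import Mathlib

open MeasureTheory ProbabilityTheory
open scoped ENNReal Matrix

noncomputable section

namespace MatrixInvariance

/-- The normalized inner product `⟨P, Q⟩ = (1/N) Tr P† Q` on `N × N` complex matrices; the square of
the normalized 2-norm of `P` is `⟨P, P⟩`. -/
def normInner {κ : Type*} [Fintype κ] (P Q : Matrix κ κ ℂ) : ℂ :=
  (Fintype.card κ : ℂ)⁻¹ * Matrix.trace (Pᴴ * Q)

/-- A standard orthonormal basis of the `m × m` matrices: `m²` Hermitian matrices, orthonormal for
the normalized inner product (hence a basis, by dimension), the first of which is the identity. -/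
structure IsStandardOrthonormalBasis {m : ℕ} [NeZero m]
    (B : Fin (m ^ 2) → Matrix (Fin m) (Fin m) ℂ) : Prop where
  hermitian : ∀ i, (B i).IsHermitian
  orthonormal : ∀ i j, normInner (B i) (B j) = if i = j then 1 else 0
  zero_eq_one : B 0 = 1

/-- The tensor product `B_σ = ⨂ i, B_{σ i}`, acting on `⨂ i, ℂ^m`, whose standard basis is indexed
by the functions `ι → Fin m`. -/
def tensorBasis {m k : ℕ} {ι : Type*} [Fintype ι] (B : Fin k → Matrix (Fin m) (Fin m) ℂ)
    (σ : ι → Fin k) : Matrix (ι → Fin m) (ι → Fin m) ℂ :=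
  Matrix.of fun a b => ∏ i, B (σ i) (a i) (b i)

/-- The Fourier coefficient of `P` at `σ` with respect to `B`; for a Hermitian `P` the inner
product is real. -/
def fourierCoeff {m n : ℕ} (B : Fin (m ^ 2) → Matrix (Fin m) (Fin m) ℂ)
    (P : Matrix (Fin n → Fin m) (Fin n → Fin m) ℂ) (σ : Fin n → Fin (m ^ 2)) : ℝ :=
  (normInner (tensorBasis B σ) P).re

/-- The number `|σ|` of nonzero entries of a multi-index. -/
def weight {n k : ℕ} [NeZero k] (σ : Fin n → Fin k) : ℕ :=
  (Finset.univ.filter fun i => σ i ≠ 0).card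

open Classical in
/-- The degree of `P`: the largest `|σ|` over the `σ` with nonzero Fourier coefficient (`0` for
`P = 0`). -/
def degree {m n : ℕ} [NeZero m] (B : Fin (m ^ 2) → Matrix (Fin m) (Fin m) ℂ)
    (P : Matrix (Fin n → Fin m) (Fin n → Fin m) ℂ) : ℕ :=
  (Finset.univ.filter fun σ => fourierCoeff B P σ ≠ 0).sup weight

/-- The operator `(id_m / m) ⊗ Tr_i P`, where the identity is placed in the `i`-th register and
`Tr_i` is the partial trace over the `i`-th register. -/
def averageOut {m n : ℕ} (i : Fin n) (P : Matrix (Fin n → Fin m) (Fin n → Fin m) ℂ) :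
    Matrix (Fin n → Fin m) (Fin n → Fin m) ℂ :=
  Matrix.of fun a b =>
    if a i = b i then
      (m : ℂ)⁻¹ * ∑ c : Fin m, P (Function.update a i c) (Function.update b i c)
    else 0

/-- The influence of the `i`-th register: the squared normalized 2-norm of
`P - (id_m / m) ⊗ Tr_i P`. -/
def influence {m n : ℕ} (i : Fin n) (P : Matrix (Fin n → Fin m) (Fin n → Fin m) ℂ) : ℝ :=
  (normInner (P - averageOut i P) (P - averageOut i P)).re

/-- `ζ(x) = x²` for `x ≤ 0` and `ζ(x) = 0` otherwise. -/
def zeta (x : ℝ) : ℝ := if x ≤ 0 then x ^ 2 else 0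

/-- `Tr ζ(M)`, where `ζ` acts on the Hermitian matrix `M` through its spectral decomposition. -/
def traceZeta {κ : Type*} [Fintype κ] [DecidableEq κ] (M : Matrix κ κ ℂ) : ℝ :=
  (Matrix.trace (cfc zeta M)).re

/-- A `(k, n)` ensemble: `n` independent families `x_i = (x_{i,0} = 1, x_{i,1}, …, x_{i,k-1})` of
real random variables, each of which is orthonormal in `L²`. -/
structure IsEnsemble {k n : ℕ} [NeZero k] {Ω : Type*} [MeasurableSpace Ω]
    (x : Fin n → Fin k → Ω → ℝ) (μ : Measure Ω) : Prop where
  measurable : ∀ i j, Measurable (x i j)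
  memLp_two : ∀ i j, MemLp (x i j) 2 μ
  zero_eq_one : ∀ i ω, x i 0 ω = 1
  orthonormal : ∀ i j l, ∫ ω, x i j ω * x i l ω ∂μ = if j = l then 1 else 0
  indep : iIndepFun (fun i ω j => x i j ω) μ

/-- The multilinear polynomial `Q(x) = ∑_τ Q̂(τ) ∏_i x_{i, τ i}` with coefficients `Q̂`. -/
def multilinearEval {k n : ℕ} {Ω : Type*} (x : Fin n → Fin k → Ω → ℝ)
    (Q : (Fin n → Fin k) → ℝ) (ω : Ω) : ℝ :=
  ∑ τ, Q τ * ∏ i, x i (τ i) ω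

/-- The noise operator `T_γ` on the coefficients of a multilinear polynomial. -/
def noiseOp {k n : ℕ} [NeZero k] (γ : ℝ) (Q : (Fin n → Fin k) → ℝ) : (Fin n → Fin k) → ℝ :=
  fun τ => γ ^ weight τ * Q τ

/-- `(p, q, η)`-hypercontractivity: `‖(T_η Q)(x)‖_q ≤ ‖Q(x)‖_p` for all multilinear `Q`. -/
def IsHypercontractive {k n : ℕ} [NeZero k] {Ω : Type*} [MeasurableSpace Ω]
    (x : Fin n → Fin k → Ω → ℝ) (μ : Measure Ω) (p q : ℝ≥0∞) (η : ℝ) : Prop :=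
  ∀ Q : (Fin n → Fin k) → ℝ,
    eLpNorm (multilinearEval x (noiseOp η Q)) q μ ≤ eLpNorm (multilinearEval x Q) p μ

/-- The random matrix `P^H(x) = ∑_σ P̂(σ) (∏_{i ∉ H} x_{i, σ i}) ⨂_{i ∈ H} B_{σ i}`. -/
def randomSubst {m n : ℕ} {Ω : Type*} (B : Fin (m ^ 2) → Matrix (Fin m) (Fin m) ℂ)
    (H : Finset (Fin n)) (P : Matrix (Fin n → Fin m) (Fin n → Fin m) ℂ)
    (x : Fin n → Fin (m ^ 2) → Ω → ℝ) (ω : Ω) : Matrix (H → Fin m) (H → Fin m) ℂ :=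
  ∑ σ : Fin n → Fin (m ^ 2),
    ((fourierCoeff B P σ * ∏ i ∈ Hᶜ, x i (σ i) ω : ℝ) : ℂ) •
      tensorBasis B (fun i : H => σ i)

end MatrixInvariance

end

/-! The proof is a Lindeberg replacement carried out on resolvents instead of on a smoothed `ζ`.
Since `ζ(t) = (t² - t|t|)/2` and `t|t| = (2/π) ∫₀^∞ t³/(t² + y²) dy`, while `t³/(t² + y²) = t - y²
Re (t - iy)⁻¹`, the normalized trace of `ζ(M)` is determined by the normalized second moment of `M`,
its normalized trace and the traces of the resolvents `(M - iy)⁻¹`, `y > 0`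
(`traceZeta_eq_integral`). The expected second moment and trace depend only on the Fourier
coefficients, so they are the same before and after substitution; only the resolvents have to be
compared.

The registers outside `H` are substituted one at a time. Write a hybrid as `A + R`, with `R` the
part that involves register `i`, and expand the resolvent to third order at `A`. In the kept
register the basis matrices are traceless and orthonormal; in the substituted one the variables are
centred, orthonormal and independent of the rest. Hence the zeroth, first and second order terms
have equal expectations (`abs_integral_rsv_sub_le`). The third order remainder is at most `y⁻⁴`
times the geometric mean of the second and fourth normalized moments of `R`, without any operator
norm of `R` (`rsv_remainder_sq_le`).

The fourth moment is controlled by hypercontractivity: a noncommutative version for the kept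
registers, with noise rate `γ` such that `9mγ² ≤ 1` (`nsq_partialEval_noiseOp_le`), combined with
the assumed one for the ensemble (`integral_nsq_partialEval_mul_self_le`). With `K = max(9m, 1/η⁴)`,
each replacement costs at most `2 y⁻⁴ K^d √τ Inf_i`, and the influences sum to at most `d`.

With `ε = 2 K^d √τ d`, the integrand of the difference is therefore at most `ε/y²`, and also at most
`2y` because a resolvent has normalized trace at most `1/y`. Cutting the integral at `y = ε^(1/3)`
gives `3 ε^(2/3)`. -/

noncomputable section

namespace MatrixInvariance

/-! ### Normalized trace and Hilbert–Schmidt norm. -/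

section NormalizedTrace

variable {κ : Type*} [Fintype κ]

/-- The real part of the normalized trace. -/
def ntr (X : Matrix κ κ ℂ) : ℝ := (Fintype.card κ : ℝ)⁻¹ * (Matrix.trace X).re

/-- The squared normalized 2-norm. -/
def nsq (X : Matrix κ κ ℂ) : ℝ := ntr (Xᴴ * X)

lemma ntr_zero : ntr (0 : Matrix κ κ ℂ) = 0 := by simp [ntr]

lemma ntr_add (X Y : Matrix κ κ ℂ) : ntr (X + Y) = ntr X + ntr Y := by
  simp [ntr, Matrix.trace_add, mul_add]

lemma ntr_sub (X Y : Matrix κ κ ℂ) : ntr (X - Y) = ntr X - ntr Y := by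
  simp [ntr, Matrix.trace_sub, mul_sub]

lemma ntr_smul (c : ℝ) (X : Matrix κ κ ℂ) : ntr (c • X) = c * ntr X := by
  simp [ntr, Matrix.trace_smul]; ring

lemma ntr_sum {ι : Type*} (s : Finset ι) (f : ι → Matrix κ κ ℂ) :
    ntr (∑ i ∈ s, f i) = ∑ i ∈ s, ntr (f i) := by
  simp [ntr, Matrix.trace_sum, Finset.mul_sum]

lemma ntr_mul_comm (X Y : Matrix κ κ ℂ) : ntr (X * Y) = ntr (Y * X) := by
  rw [ntr, Matrix.trace_mul_comm, ntr]

lemma ntr_conjTranspose (X : Matrix κ κ ℂ) : ntr Xᴴ = ntr X := by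
  simp [ntr, Matrix.trace_conjTranspose]

lemma ntr_one [DecidableEq κ] [Nonempty κ] : ntr (1 : Matrix κ κ ℂ) = 1 := by
  simp [ntr, Matrix.trace_one]

lemma nsq_nonneg (X : Matrix κ κ ℂ) : 0 ≤ nsq X := by
  have h : (Matrix.trace (Xᴴ * X)).re = ∑ i, ∑ j, Complex.normSq (X j i) := by
    simp [Matrix.trace, Matrix.mul_apply, Complex.normSq_apply]
  rw [nsq, ntr, h]
  exact mul_nonneg (by positivity)
    (Finset.sum_nonneg fun i _ => Finset.sum_nonneg fun j _ => Complex.normSq_nonneg _)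

lemma nsq_eq_zero {X : Matrix κ κ ℂ} (hX : nsq X = 0) : X = 0 := by
  have h : (Matrix.trace (Xᴴ * X)).re = ∑ i, ∑ j, Complex.normSq (X j i) := by
    simp [Matrix.trace, Matrix.mul_apply, Complex.normSq_apply]
  ext a b
  have : Nonempty κ := ⟨a⟩
  rw [nsq, ntr, h, mul_eq_zero] at hX
  rcases hX with hX | hX
  · simp at hX
  · rw [Finset.sum_eq_zero_iff_of_nonneg
      fun i _ => Finset.sum_nonneg fun j _ => Complex.normSq_nonneg _] at hX
    have h2 := hX b (Finset.mem_univ _)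
    rw [Finset.sum_eq_zero_iff_of_nonneg fun j _ => Complex.normSq_nonneg _] at h2
    simpa using h2 a (Finset.mem_univ _)

lemma nsq_conjTranspose (X : Matrix κ κ ℂ) : nsq Xᴴ = nsq X := by
  rw [nsq, nsq, Matrix.conjTranspose_conjTranspose, ntr_mul_comm]

lemma ntr_conjTranspose_mul_comm (X Y : Matrix κ κ ℂ) : ntr (Xᴴ * Y) = ntr (Yᴴ * X) := by
  rw [← ntr_conjTranspose]; simp

/-- The Cauchy-Schwarz inequality for the normalized Hilbert-Schmidt inner product. -/
lemma ntr_conjTranspose_mul_sq_le (X Y : Matrix κ κ ℂ) :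
    ntr (Xᴴ * Y) ^ 2 ≤ nsq X * nsq Y := by
  have h : ∀ t : ℝ, 0 ≤ nsq Y * (t * t) + (2 * ntr (Xᴴ * Y)) * t + nsq X := by
    intro t
    have h1 := nsq_nonneg (X + t • Y)
    have h2 : nsq (X + t • Y) = nsq Y * (t * t) + (2 * ntr (Xᴴ * Y)) * t + nsq X := by
      have h3 := ntr_conjTranspose_mul_comm Y X
      simp only [nsq, Matrix.conjTranspose_add, Matrix.conjTranspose_smul, star_trivial, add_mul,
        mul_add, ntr_add, smul_mul_assoc, mul_smul_comm, ntr_smul, h3]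
      ring
    rwa [h2] at h1
  have := discrim_le_zero h
  rw [discrim] at this
  nlinarith

lemma ntr_mul_sq_le (X Y : Matrix κ κ ℂ) : ntr (X * Y) ^ 2 ≤ nsq X * nsq Y := by
  have := ntr_conjTranspose_mul_sq_le Xᴴ Y
  rwa [Matrix.conjTranspose_conjTranspose, nsq_conjTranspose] at this

lemma two_mul_abs_ntr_mul_le (X Y : Matrix κ κ ℂ) : 2 * |ntr (X * Y)| ≤ nsq X + nsq Y := by
  have h := ntr_mul_sq_le X Y
  have h1 := nsq_nonneg X
  have h2 := nsq_nonneg Y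
  have : |2 * ntr (X * Y)| ≤ nsq X + nsq Y :=
    abs_le_of_sq_le_sq (by nlinarith [sq_nonneg (nsq X - nsq Y)]) (by positivity)
  rwa [abs_mul, abs_two] at this

end NormalizedTrace

/-! ### Resolvents on the imaginary axis and their third order expansion. -/

section Resolvent

variable {κ : Type*} [Fintype κ] [DecidableEq κ]

/-- The resolvent `(A - iy)⁻¹`. -/
def rsv (A : Matrix κ κ ℂ) (y : ℝ) : Matrix κ κ ℂ :=
  (A - ((y : ℂ) * Complex.I) • (1 : Matrix κ κ ℂ))⁻¹

variable {A : Matrix κ κ ℂ} {y : ℝ}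

/-- The cross terms cancel because `A` is Hermitian and the shift is purely imaginary. Invertibility
of `A - iy` and the bound `1/|y|` for multiplication by the resolvent both follow from this
identity, without spectral theory. -/
lemma nsq_sub_mul (hA : A.IsHermitian) (Z : Matrix κ κ ℂ) :
    nsq ((A - ((y : ℂ) * Complex.I) • (1 : Matrix κ κ ℂ)) * Z) = nsq (A * Z) + y ^ 2 * nsq Z := by
  have h1 : ((A - ((y : ℂ) * Complex.I) • (1 : Matrix κ κ ℂ)) * Z)ᴴ *
      ((A - ((y : ℂ) * Complex.I) • (1 : Matrix κ κ ℂ)) * Z) =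
      (A * Z)ᴴ * (A * Z) + (y ^ 2 : ℝ) • (Zᴴ * Z) := by
    have hs : star ((y : ℂ) * Complex.I) = -((y : ℂ) * Complex.I) := by simp
    simp only [Matrix.conjTranspose_mul, Matrix.conjTranspose_sub, Matrix.conjTranspose_smul,
      hA.eq, Matrix.conjTranspose_one, hs]
    have h2 : ((y : ℂ) * Complex.I) * ((y : ℂ) * Complex.I) = -((y ^ 2 : ℝ) : ℂ) := by
      push_cast; linear_combination (y : ℂ) ^ 2 * Complex.I_mul_I
    have h3 : (y ^ 2 : ℝ) • (Zᴴ * Z) = ((y ^ 2 : ℝ) : ℂ) • (Zᴴ * Z) := by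
      rw [Complex.coe_smul]
    rw [h3, ← neg_neg (((y ^ 2 : ℝ) : ℂ)), ← h2]
    generalize (y : ℂ) * Complex.I = c
    simp only [sub_mul, mul_sub, smul_mul_assoc, mul_smul_comm, one_mul, mul_one, neg_smul,
      Matrix.mul_assoc, smul_smul, sub_neg_eq_add, mul_add, add_mul, smul_add]
    abel
  rw [nsq, h1, ntr_add, ntr_smul]; rfl

lemma isUnit_sub_smul_one (hA : A.IsHermitian) (hy : y ≠ 0) :
    IsUnit (A - ((y : ℂ) * Complex.I) • (1 : Matrix κ κ ℂ)) := by
  rw [Matrix.isUnit_iff_isUnit_det, isUnit_iff_ne_zero]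
  intro h0
  obtain ⟨v, hv, hv0⟩ := Matrix.exists_mulVec_eq_zero_iff.mpr h0
  -- The kernel vector is copied into every column, so that the identity for square matrices applies
  -- to it.
  have h := nsq_sub_mul (y := y) hA (Matrix.of fun a (_ : κ) => v a)
  have h1 : (A - ((y : ℂ) * Complex.I) • (1 : Matrix κ κ ℂ)) * (Matrix.of fun a (_ : κ) => v a)
      = 0 := by
    ext a b
    have := congrFun hv0 a
    simpa [Matrix.mul_apply, Matrix.mulVec, dotProduct] using this
  rw [h1] at h
  have h2 : nsq (Matrix.of fun a (_ : κ) => v a) = 0 := by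
    have h3 := nsq_nonneg (A * (Matrix.of fun a (_ : κ) => v a))
    have h4 := nsq_nonneg (Matrix.of fun a (_ : κ) => v a)
    have h5 : nsq (0 : Matrix κ κ ℂ) = 0 := by simp [nsq, ntr_zero]
    have h6 : 0 < y ^ 2 := by positivity
    nlinarith
  apply hv
  ext a
  have := congrFun (congrFun (nsq_eq_zero h2) a) a
  simpa using this

lemma sub_mul_rsv (hA : A.IsHermitian) (hy : y ≠ 0) :
    (A - ((y : ℂ) * Complex.I) • (1 : Matrix κ κ ℂ)) * rsv A y = 1 :=
  Matrix.mul_nonsing_inv _ ((Matrix.isUnit_iff_isUnit_det _).mp (isUnit_sub_smul_one hA hy))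

lemma rsv_mul_sub (hA : A.IsHermitian) (hy : y ≠ 0) :
    rsv A y * (A - ((y : ℂ) * Complex.I) • (1 : Matrix κ κ ℂ)) = 1 :=
  Matrix.nonsing_inv_mul _ ((Matrix.isUnit_iff_isUnit_det _).mp (isUnit_sub_smul_one hA hy))

lemma rsv_conjTranspose (hA : A.IsHermitian) : (rsv A y)ᴴ = rsv A (-y) := by
  rw [rsv, rsv, Matrix.conjTranspose_nonsing_inv]
  simp [hA.eq, Matrix.conjTranspose_smul]

lemma nsq_rsv_mul_le (hA : A.IsHermitian) (hy : y ≠ 0) (X : Matrix κ κ ℂ) :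
    nsq (rsv A y * X) ≤ (y ^ 2)⁻¹ * nsq X := by
  have h := nsq_sub_mul (y := y) hA (rsv A y * X)
  rw [← Matrix.mul_assoc, sub_mul_rsv hA hy, one_mul] at h
  have h3 := nsq_nonneg (A * (rsv A y * X))
  have h6 : 0 < y ^ 2 := by positivity
  rw [inv_mul_eq_div, le_div_iff₀ h6]
  linarith

lemma nsq_mul_rsv_le (hA : A.IsHermitian) (hy : y ≠ 0) (X : Matrix κ κ ℂ) :
    nsq (X * rsv A y) ≤ (y ^ 2)⁻¹ * nsq X := by
  rw [← nsq_conjTranspose, Matrix.conjTranspose_mul, rsv_conjTranspose hA,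
    ← nsq_conjTranspose X]
  simpa using nsq_rsv_mul_le hA (neg_ne_zero.mpr hy) Xᴴ

lemma rsv_add (hA : A.IsHermitian) {R : Matrix κ κ ℂ} (hR : R.IsHermitian) (hy : y ≠ 0) :
    rsv (A + R) y = rsv A y - rsv A y * R * rsv (A + R) y := by
  have h1 := rsv_mul_sub hA hy
  have h2 := sub_mul_rsv (hA.add hR) hy
  have h3 : A + R - ((y : ℂ) * Complex.I) • (1 : Matrix κ κ ℂ) =
    (A - ((y : ℂ) * Complex.I) • (1 : Matrix κ κ ℂ)) + R := by abel
  rw [h3] at h2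
  calc rsv (A + R) y = rsv A y * (A - ((y : ℂ) * Complex.I) • (1 : Matrix κ κ ℂ)) *
        rsv (A + R) y := by rw [h1, one_mul]
    _ = rsv A y * (((A - ((y : ℂ) * Complex.I) • (1 : Matrix κ κ ℂ)) + R) * rsv (A + R) y)
        - rsv A y * R * rsv (A + R) y := by noncomm_ring
    _ = _ := by rw [h2, mul_one]

/-- The third order expansion of the resolvent. -/
lemma rsv_add_expansion (hA : A.IsHermitian) {R : Matrix κ κ ℂ} (hR : R.IsHermitian)
    (hy : y ≠ 0) :
    rsv (A + R) y = rsv A y - rsv A y * R * rsv A y + rsv A y * R * rsv A y * R * rsv A y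
      - (rsv A y * R * rsv A y * R) * (rsv A y * R * rsv (A + R) y) := by
  have h := rsv_add hA hR hy
  generalize rsv (A + R) y = G' at *
  generalize rsv A y = G at *
  have h1 : G - G * R * G' = G - G * R * (G - G * R * G') := congrArg (fun X => G - G * R * X) h
  have h2 : G - G * R * (G - G * R * G') = G - G * R * (G - G * R * (G - G * R * G')) :=
    congrArg (fun X => G - G * R * (G - G * R * X)) h
  refine (h.trans (h1.trans h2)).trans ?_
  noncomm_ring

/-- By cyclicity the left side pairs `R²` with `Gᴴ R² G`, and Cauchy–Schwarz bounds this by the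
fourth moment of `R`, the two resolvents costing `y⁻²`. This is what avoids the operator norm of
`R`. -/
lemma nsq_mul_rsv_mul_le (hA : A.IsHermitian) {R : Matrix κ κ ℂ} (hR : R.IsHermitian)
    (hy : y ≠ 0) : nsq (R * rsv A y * R) ≤ (y ^ 2)⁻¹ * nsq (R * R) := by
  set G := rsv A y with hG
  have h1 : nsq (R * G * R) = ntr ((R * R) * (Gᴴ * (R * R) * G)) := by
    rw [nsq, ntr_mul_comm (R * R)]
    simp only [Matrix.conjTranspose_mul, hR.eq]
    rw [show R * (Gᴴ * R) * (R * G * R) = R * (Gᴴ * (R * R) * G * R) by noncomm_ring,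
      ntr_mul_comm]
    congr 1; noncomm_ring
  have h2 : nsq (Gᴴ * (R * R) * G) ≤ (y ^ 2)⁻¹ * ((y ^ 2)⁻¹ * nsq (R * R)) := by
    refine (nsq_mul_rsv_le hA hy _).trans ?_
    gcongr
    rw [hG, rsv_conjTranspose hA]
    simpa using nsq_rsv_mul_le hA (neg_ne_zero.mpr hy) (R * R)
  have h3 := ntr_mul_sq_le (R * R) (Gᴴ * (R * R) * G)
  have h0 := nsq_nonneg (R * R)
  rw [h1]
  refine (abs_le_of_sq_le_sq' ?_ (by positivity)).2
  refine h3.trans ((mul_le_mul_of_nonneg_left h2 h0).trans (le_of_eq (by ring)))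

/-- The three copies of `R` are divided two against one before Cauchy–Schwarz; each half contains
two resolvents, whence `y⁻⁴` on each squared norm. -/
lemma rsv_remainder_sq_le (hA : A.IsHermitian) {R : Matrix κ κ ℂ} (hR : R.IsHermitian)
    (hy : y ≠ 0) :
    ntr ((rsv A y * R * rsv A y * R) * (rsv A y * R * rsv (A + R) y)) ^ 2 ≤
      (y ^ 8)⁻¹ * (nsq R * nsq (R * R)) := by
  have h0 := nsq_nonneg (R * R)
  have h1 := nsq_nonneg R
  have h2 : nsq (rsv A y * R * rsv A y * R) ≤ (y ^ 2)⁻¹ * ((y ^ 2)⁻¹ * nsq (R * R)) := by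
    rw [show rsv A y * R * rsv A y * R = rsv A y * (R * rsv A y * R) by noncomm_ring]
    refine (nsq_rsv_mul_le hA hy _).trans ?_
    gcongr
    exact nsq_mul_rsv_mul_le hA hR hy
  have h3 : nsq (rsv A y * R * rsv (A + R) y) ≤ (y ^ 2)⁻¹ * ((y ^ 2)⁻¹ * nsq R) := by
    refine (nsq_mul_rsv_le (hA.add hR) hy _).trans ?_
    gcongr
    exact nsq_rsv_mul_le hA hy _
  refine (ntr_mul_sq_le _ _).trans ((mul_le_mul h2 h3 (nsq_nonneg _) (by positivity)).trans
    (le_of_eq (by ring)))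

lemma commute_rsv {Y : Matrix κ κ ℂ} (h : Commute A Y) (hA : A.IsHermitian) (hy : y ≠ 0) :
    Commute (rsv A y) Y := by
  have h1 : Commute (A - ((y : ℂ) * Complex.I) • (1 : Matrix κ κ ℂ)) Y :=
    h.sub_left ((Commute.one_left Y).smul_left _)
  have h2 := sub_mul_rsv hA hy
  have h3 := rsv_mul_sub hA hy
  generalize A - ((y : ℂ) * Complex.I) • (1 : Matrix κ κ ℂ) = D at *
  change rsv A y * Y = Y * rsv A y
  calc rsv A y * Y = rsv A y * Y * (D * rsv A y) := by rw [h2, mul_one]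
    _ = rsv A y * (Y * D) * rsv A y := by noncomm_ring
    _ = rsv A y * (D * Y) * rsv A y := by rw [h1.eq]
    _ = (rsv A y * D) * Y * rsv A y := by noncomm_ring
    _ = _ := by rw [h3, one_mul]

lemma abs_ntr_rsv_le [Nonempty κ] (hA : A.IsHermitian) (hy : 0 < y) :
    |ntr (rsv A y)| ≤ y⁻¹ := by
  have h := ntr_mul_sq_le 1 (rsv A y)
  have h1 := nsq_mul_rsv_le hA hy.ne' 1
  have h2 : nsq (1 : Matrix κ κ ℂ) = 1 := by simp [nsq, ntr_one]
  rw [one_mul, h2, mul_one] at h1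
  rw [one_mul, h2, one_mul] at h
  refine abs_le_of_sq_le_sq (h.trans (h1.trans (le_of_eq (by rw [inv_pow])))) (by positivity)

end Resolvent

/-! ### Tensor products and operators on a single register. -/

section Tensor

variable {ι : Type*} [Fintype ι] {m : ℕ}

/-- The tensor product of a family of matrices. -/
def tens (Y : ι → Matrix (Fin m) (Fin m) ℂ) : Matrix (ι → Fin m) (ι → Fin m) ℂ :=
  Matrix.of fun a b => ∏ i, Y i (a i) (b i)

lemma tens_apply (Y : ι → Matrix (Fin m) (Fin m) ℂ) (a b : ι → Fin m) :
    tens Y a b = ∏ i, Y i (a i) (b i) := rfl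

lemma tensorBasis_eq_tens {k : ℕ} (B : Fin k → Matrix (Fin m) (Fin m) ℂ) (σ : ι → Fin k) :
    tensorBasis B σ = tens fun i => B (σ i) := rfl

lemma tens_conjTranspose (Y : ι → Matrix (Fin m) (Fin m) ℂ) :
    (tens Y)ᴴ = tens fun i => (Y i)ᴴ := by
  ext a b
  simp [tens_apply, Matrix.conjTranspose_apply]

lemma tens_one : tens (fun _ : ι => (1 : Matrix (Fin m) (Fin m) ℂ)) = 1 := by
  ext a b
  simp only [tens_apply, Matrix.one_apply, Finset.prod_ite_zero, funext_iff]
  simp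

variable [DecidableEq ι]

lemma tens_mul (Y Z : ι → Matrix (Fin m) (Fin m) ℂ) :
    tens Y * tens Z = tens fun i => Y i * Z i := by
  ext a b
  simp only [tens_apply, Matrix.mul_apply, ← Finset.prod_mul_distrib]
  rw [Finset.prod_univ_sum, Fintype.piFinset_univ]

lemma trace_tens (Y : ι → Matrix (Fin m) (Fin m) ℂ) :
    Matrix.trace (tens Y) = ∏ i, Matrix.trace (Y i) := by
  simp only [Matrix.trace, Matrix.diag_apply, tens_apply]
  rw [Finset.prod_univ_sum, Fintype.piFinset_univ]

/-- The operator acting as `Y` on register `i` and as the identity elsewhere. -/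
def emb (i : ι) (Y : Matrix (Fin m) (Fin m) ℂ) : Matrix (ι → Fin m) (ι → Fin m) ℂ :=
  tens (Function.update 1 i Y)

lemma emb_apply (i : ι) (Y : Matrix (Fin m) (Fin m) ℂ) (a b : ι → Fin m) :
    emb i Y a b = Y (a i) (b i) *
      ∏ k ∈ Finset.univ.erase i, (1 : Matrix (Fin m) (Fin m) ℂ) (a k) (b k) := by
  rw [emb, tens_apply, ← Finset.mul_prod_erase _ _ (Finset.mem_univ i)]
  congr 1
  · simp
  · refine Finset.prod_congr rfl fun k hk => ?_
    rw [Function.update_of_ne (Finset.ne_of_mem_erase hk)]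
    rfl

lemma emb_mul (i : ι) (Y Z : Matrix (Fin m) (Fin m) ℂ) : emb i Y * emb i Z = emb i (Y * Z) := by
  rw [emb, emb, tens_mul, emb]
  congr 1
  ext1 k
  rcases eq_or_ne k i with rfl | h
  · simp
  · simp [h]

lemma emb_one (i : ι) : emb i (1 : Matrix (Fin m) (Fin m) ℂ) = 1 := by
  rw [emb, ← tens_one]
  congr 1
  ext1 k
  rcases eq_or_ne k i with rfl | h
  · simp
  · simp [h]

lemma emb_sum {α : Type*} (s : Finset α) (i : ι) (Y : α → Matrix (Fin m) (Fin m) ℂ) :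
    emb i (∑ k ∈ s, Y k) = ∑ k ∈ s, emb i (Y k) := by
  ext a b
  simp only [Matrix.sum_apply, emb_apply, Finset.sum_mul]

lemma emb_smul (i : ι) (c : ℂ) (Y : Matrix (Fin m) (Fin m) ℂ) :
    emb i (c • Y) = c • emb i Y := by
  ext a b
  simp only [Matrix.smul_apply, emb_apply, smul_eq_mul, mul_assoc]

lemma emb_isHermitian (i : ι) {Y : Matrix (Fin m) (Fin m) ℂ} (hY : Y.IsHermitian) :
    (emb i Y).IsHermitian := by
  rw [Matrix.IsHermitian, emb, tens_conjTranspose]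
  congr 1
  ext1 k
  rcases eq_or_ne k i with rfl | h
  · simp [hY.eq]
  · simp [h]

end Tensor

/-! ### Standard bases: completeness, Fourier expansion, trace identities on one register. -/

section Basis

variable {m : ℕ} [NeZero m] {B : Fin (m ^ 2) → Matrix (Fin m) (Fin m) ℂ}

/-- Completeness of a standard orthonormal basis. -/
lemma IsStandardOrthonormalBasis.complete (hB : IsStandardOrthonormalBasis B) (a b c d : Fin m) :
    ∑ j, B j a b * star (B j c d) = if a = c ∧ b = d then (m : ℂ) else 0 := by
  let U : Matrix (Fin (m ^ 2)) (Fin m × Fin m) ℂ := Matrix.of fun j p => star (B j p.1 p.2)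
  let V : Matrix (Fin m × Fin m) (Fin (m ^ 2)) ℂ := Matrix.of fun p j => (m : ℂ)⁻¹ * B j p.1 p.2
  have hm : (m : ℂ) ≠ 0 := Nat.cast_ne_zero.mpr (NeZero.ne m)
  -- Orthonormality makes `V` a right inverse of `U`. Both index sets have `m²` elements, so it is
  -- also a left inverse, and that is completeness.
  have hUV : U * V = 1 := by
    ext i j
    have h := hB.orthonormal i j
    rw [normInner, Fintype.card_fin] at h
    rw [Matrix.one_apply, ← h, Matrix.mul_apply, Fintype.sum_prod_type, Matrix.trace,
      Finset.mul_sum, Finset.sum_comm]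
    refine Finset.sum_congr rfl fun x _ => ?_
    rw [Matrix.diag_apply, Matrix.mul_apply, Finset.mul_sum]
    refine Finset.sum_congr rfl fun y _ => ?_
    simp only [U, V, Matrix.of_apply, Matrix.conjTranspose_apply]
    ring
  have e : Fin (m ^ 2) ≃ Fin m × Fin m := Fintype.equivOfCardEq (by simp [sq])
  have hVU : V * U = 1 := (Matrix.mul_eq_one_comm_of_equiv e).mp hUV
  have h := congrFun (congrFun hVU (a, b)) (c, d)
  rw [Matrix.mul_apply, Matrix.one_apply] at h
  have h2 : ∑ j, B j a b * star (B j c d) = (m : ℂ) * ∑ j, V (a, b) j * U j (c, d) := by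
    rw [Finset.mul_sum]
    refine Finset.sum_congr rfl fun j _ => ?_
    simp only [U, V, Matrix.of_apply]
    field_simp
  rw [h2, h]
  simp [Prod.ext_iff]

lemma IsStandardOrthonormalBasis.star_apply (hB : IsStandardOrthonormalBasis B) (j : Fin (m ^ 2))
    (a b : Fin m) : star (B j a b) = B j b a := by
  conv_rhs => rw [← (hB.hermitian j).eq]
  rfl

/-- This follows from completeness entry by entry. Conjugating by the whole basis acts as a trace
over the register, and is used in place of a partial trace. -/
lemma IsStandardOrthonormalBasis.sum_conj (hB : IsStandardOrthonormalBasis B)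
    (Y : Matrix (Fin m) (Fin m) ℂ) :
    ∑ k, B k * Y * B k = ((m : ℂ) * Matrix.trace Y) • (1 : Matrix (Fin m) (Fin m) ℂ) := by
  ext a d
  have h : ∀ k, (B k * Y * B k) a d = ∑ c, ∑ b, Y b c * (B k a b * star (B k d c)) := by
    intro k
    simp only [Matrix.mul_apply, Finset.sum_mul, hB.star_apply]
    exact Finset.sum_congr rfl fun c _ => Finset.sum_congr rfl fun b _ => by ring
  simp only [Matrix.sum_apply, h]
  rw [Finset.sum_comm]
  simp only [Finset.sum_comm (s := (Finset.univ : Finset (Fin (m ^ 2)))), ← Finset.mul_sum,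
    hB.complete]
  by_cases had : a = d
  · simp [had, Matrix.trace, Finset.mul_sum, mul_comm]
  · simp [had]

lemma IsStandardOrthonormalBasis.sum_sq (hB : IsStandardOrthonormalBasis B) :
    ∑ k, B k * B k = ((m : ℂ) ^ 2) • (1 : Matrix (Fin m) (Fin m) ℂ) := by
  have := hB.sum_conj 1
  simpa [Matrix.trace_one, sq] using this

lemma IsStandardOrthonormalBasis.trace_mul (hB : IsStandardOrthonormalBasis B)
    (i j : Fin (m ^ 2)) : Matrix.trace (B i * B j) = if i = j then (m : ℂ) else 0 := by
  have hm : (m : ℂ) ≠ 0 := Nat.cast_ne_zero.mpr (NeZero.ne m)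
  have h := hB.orthonormal i j
  rw [normInner, Fintype.card_fin, (hB.hermitian i).eq, inv_mul_eq_iff_eq_mul₀ hm] at h
  rw [h]; simp

variable {n : ℕ}

lemma tensorBasis_isHermitian {ι : Type*} [Fintype ι] (hB : IsStandardOrthonormalBasis B)
    (σ : ι → Fin (m ^ 2)) : (tensorBasis B σ).IsHermitian := by
  rw [tensorBasis_eq_tens, Matrix.IsHermitian, tens_conjTranspose]
  simp only [(hB.hermitian _).eq]

/-- The Fourier expansion with complex coefficients. -/
lemma sum_normInner_smul_tensorBasis (hB : IsStandardOrthonormalBasis B)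
    (P : Matrix (Fin n → Fin m) (Fin n → Fin m) ℂ) :
    ∑ σ, normInner (tensorBasis B σ) P • tensorBasis B σ = P := by
  have hm : (m : ℂ) ≠ 0 := Nat.cast_ne_zero.mpr (NeZero.ne m)
  have hc : ∀ a b c d : Fin n → Fin m, ∑ σ, tensorBasis B σ a b * star (tensorBasis B σ c d) =
      if a = c ∧ b = d then (m : ℂ) ^ n else 0 := by
    intro a b c d
    simp only [tensorBasis_eq_tens, tens_apply, star_prod, ← Finset.prod_mul_distrib]
    rw [← Fintype.piFinset_univ, ← Finset.prod_univ_sum (fun _ => Finset.univ)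
      (fun i j => B j (a i) (b i) * star (B j (c i) (d i)))]
    simp only [hB.complete, Finset.prod_ite_zero, Finset.prod_const, Finset.card_univ,
      Fintype.card_fin]
    simp only [Finset.mem_univ, forall_true_left, forall_and, funext_iff]
  ext a b
  simp only [Matrix.sum_apply, Matrix.smul_apply, smul_eq_mul, normInner, Matrix.trace,
    Matrix.diag_apply, Matrix.mul_apply, Matrix.conjTranspose_apply, Fintype.card_pi,
    Fintype.card_fin, Finset.prod_const, Finset.card_univ]
  have h : ∀ σ, ((m ^ n : ℕ) : ℂ)⁻¹ * (∑ d, ∑ c, star (tensorBasis B σ c d) * P c d) *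
      tensorBasis B σ a b = ∑ d, ∑ c, (((m : ℂ) ^ n)⁻¹ * P c d) *
        (tensorBasis B σ a b * star (tensorBasis B σ c d)) := by
    intro σ
    simp only [Finset.mul_sum, Finset.sum_mul, Nat.cast_pow]
    exact Finset.sum_congr rfl fun d _ => Finset.sum_congr rfl fun c _ => by ring
  simp only [h]
  rw [Finset.sum_comm]
  simp only [Finset.sum_comm (s := (Finset.univ : Finset (Fin n → Fin (m ^ 2)))),
    ← Finset.mul_sum, hc]
  rw [Finset.sum_eq_single b, Finset.sum_eq_single a]
  · simp; field_simp
  · intro c _ hca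
    simp [Ne.symm hca]
  · simp
  · intro d _ hdb
    exact Finset.sum_eq_zero fun c _ => by simp [Ne.symm hdb]
  · simp

lemma normInner_tensorBasis_eq_fourierCoeff (hB : IsStandardOrthonormalBasis B)
    {P : Matrix (Fin n → Fin m) (Fin n → Fin m) ℂ} (hP : P.IsHermitian)
    (σ : Fin n → Fin (m ^ 2)) :
    normInner (tensorBasis B σ) P = (fourierCoeff B P σ : ℂ) := by
  rw [fourierCoeff]
  symm
  rw [← Complex.conj_eq_iff_re]
  change star _ = _
  rw [normInner, star_mul', ← Matrix.trace_conjTranspose, Matrix.conjTranspose_mul,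
    Matrix.conjTranspose_conjTranspose, (tensorBasis_isHermitian hB σ).eq, hP.eq,
    Matrix.trace_mul_comm]
  simp

/-- The Fourier expansion of a Hermitian operator. -/
lemma sum_fourierCoeff_smul_tensorBasis (hB : IsStandardOrthonormalBasis B)
    {P : Matrix (Fin n → Fin m) (Fin n → Fin m) ℂ} (hP : P.IsHermitian) :
    ∑ σ, fourierCoeff B P σ • tensorBasis B σ = P := by
  conv_rhs => rw [← sum_normInner_smul_tensorBasis hB P]
  refine Finset.sum_congr rfl fun σ _ => ?_
  rw [normInner_tensorBasis_eq_fourierCoeff hB hP, Complex.coe_smul]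

/-- Trace factorization: `X` acts trivially on register `i`. -/
lemma ntr_mul_emb (hB : IsStandardOrthonormalBasis B) (i : Fin n)
    {X : Matrix (Fin n → Fin m) (Fin n → Fin m) ℂ} (hX : ∀ k, Commute (emb i (B k)) X)
    (j l : Fin (m ^ 2)) :
    ntr (X * emb i (B j * B l)) = if j = l then ntr X else 0 := by
  have hm : (m : ℂ) ≠ 0 := Nat.cast_ne_zero.mpr (NeZero.ne m)
  -- Conjugation by all `emb i (B k)` passes through `X` and turns `B j * B l` into a scalar, which
  -- orthogonality evaluates; comparing it with the sum of squares gives the factorization.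
  have h1 : ∑ k, emb i (B k) * emb i (B k) = ((m : ℂ) ^ 2) •
      (1 : Matrix (Fin n → Fin m) (Fin n → Fin m) ℂ) := by
    simp only [emb_mul, ← emb_sum, hB.sum_sq, emb_smul, emb_one]
  have h2 : ∑ k, emb i (B k) * emb i (B j * B l) * emb i (B k) = (if j = l then (m : ℂ) ^ 2 else 0) •
      (1 : Matrix (Fin n → Fin m) (Fin n → Fin m) ℂ) := by
    simp only [emb_mul, ← emb_sum, hB.sum_conj, emb_smul, emb_one, hB.trace_mul]
    split_ifs <;> simp [sq]
  have h3 : ((m : ℂ) ^ 2) * Matrix.trace (X * emb i (B j * B l)) =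
      (if j = l then (m : ℂ) ^ 2 else 0) * Matrix.trace X := by
    calc ((m : ℂ) ^ 2) * Matrix.trace (X * emb i (B j * B l))
        = Matrix.trace (X * emb i (B j * B l) * ∑ k, emb i (B k) * emb i (B k)) := by
          rw [h1, mul_smul_comm, mul_one, Matrix.trace_smul, smul_eq_mul]
      _ = ∑ k, Matrix.trace (X * (emb i (B k) * emb i (B j * B l) * emb i (B k))) := by
          rw [Finset.mul_sum, Matrix.trace_sum]
          refine Finset.sum_congr rfl fun k _ => ?_
          rw [← mul_assoc, Matrix.trace_mul_comm, ← mul_assoc, ← mul_assoc, (hX k).eq]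
          simp only [mul_assoc]
      _ = _ := by
          rw [← Matrix.trace_sum, ← Finset.mul_sum, h2, mul_smul_comm, mul_one,
            Matrix.trace_smul, smul_eq_mul]
  rw [ntr]
  split_ifs at h3 ⊢ with hjl
  · rw [mul_left_cancel₀ (pow_ne_zero 2 hm) h3, ntr]
  · rw [zero_mul, mul_eq_zero] at h3
    rw [h3.resolve_left (pow_ne_zero 2 hm)]
    simp

lemma ntr_mul_emb_single (hB : IsStandardOrthonormalBasis B) (i : Fin n)
    {X : Matrix (Fin n → Fin m) (Fin n → Fin m) ℂ} (hX : ∀ k, Commute (emb i (B k)) X)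
    {j : Fin (m ^ 2)} (hj : j ≠ 0) : ntr (X * emb i (B j)) = 0 := by
  have := ntr_mul_emb hB i hX j 0
  rwa [hB.zero_eq_one, mul_one, if_neg hj] at this

/-- Row bound: `∑ⱼ Bⱼ Bⱼ† = m²` controls `∑ⱼ Bⱼ Zⱼ`. -/
lemma nsq_sum_emb_mul_le (hB : IsStandardOrthonormalBasis B) (i : Fin n)
    (s : Finset (Fin (m ^ 2)))
    (Z : Fin (m ^ 2) → Matrix (Fin n → Fin m) (Fin n → Fin m) ℂ) :
    nsq (∑ j ∈ s, emb i (B j) * Z j) ≤ (m : ℝ) ^ 2 * ∑ j ∈ s, nsq (Z j) := by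
  set X := ∑ j ∈ s, emb i (B j) * Z j with hXdef
  have hX0 := nsq_nonneg X
  have hm : 0 < (m : ℝ) := Nat.cast_pos.mpr (NeZero.pos m)
  have h1 : ∑ j, nsq (emb i (B j) * X) = (m : ℝ) ^ 2 * nsq X := by
    have h2 : ∑ k, emb i (B k) * emb i (B k) = ((m : ℝ) ^ 2) •
        (1 : Matrix (Fin n → Fin m) (Fin n → Fin m) ℂ) := by
      simp only [emb_mul, ← emb_sum, hB.sum_sq, emb_smul, emb_one]
      rw [← Complex.coe_smul]; simp
    calc ∑ j, nsq (emb i (B j) * X) = ∑ j, ntr (Xᴴ * (emb i (B j) * emb i (B j)) * X) := by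
          refine Finset.sum_congr rfl fun j _ => ?_
          rw [nsq, Matrix.conjTranspose_mul, (emb_isHermitian i (hB.hermitian j)).eq]
          simp only [mul_assoc]
      _ = _ := by
          rw [← ntr_sum, ← Finset.sum_mul, ← Finset.mul_sum, h2, mul_smul_comm, mul_one,
            smul_mul_assoc, ntr_smul, nsq]
  have h3 : nsq X = ∑ j ∈ s, ntr ((Z j)ᴴ * (emb i (B j) * X)) := by
    conv_lhs => rw [nsq]
    conv_lhs => enter [1, 1]; rw [hXdef]
    rw [Matrix.conjTranspose_sum, Finset.sum_mul, ntr_sum]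
    refine Finset.sum_congr rfl fun j _ => ?_
    rw [Matrix.conjTranspose_mul, (emb_isHermitian i (hB.hermitian j)).eq, mul_assoc]
  -- The weight `m²` is chosen so that, after summation, the second terms amount to at most half of
  -- `nsq X`, which is absorbed on the left.
  have h4 : ∀ j, ntr ((Z j)ᴴ * (emb i (B j) * X)) ≤
      ((m : ℝ) ^ 2 * nsq (Z j) + ((m : ℝ) ^ 2)⁻¹ * nsq (emb i (B j) * X)) / 2 := by
    intro j
    have h5 := two_mul_abs_ntr_mul_le ((m : ℝ) • (Z j)ᴴ) ((m : ℝ)⁻¹ • (emb i (B j) * X))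
    have h6 : ∀ (c : ℝ) (Y : Matrix (Fin n → Fin m) (Fin n → Fin m) ℂ),
        nsq (c • Y) = c ^ 2 * nsq Y := by
      intro c Y
      simp only [nsq, Matrix.conjTranspose_smul, star_trivial, smul_mul_assoc, mul_smul_comm,
        ntr_smul]
      ring
    rw [h6, h6, nsq_conjTranspose, smul_mul_assoc, mul_smul_comm, smul_smul,
      mul_inv_cancel₀ hm.ne', one_smul, inv_pow] at h5
    have h7 := le_abs_self (ntr ((Z j)ᴴ * (emb i (B j) * X)))
    linarith
  have h8 : ∑ j ∈ s, nsq (emb i (B j) * X) ≤ (m : ℝ) ^ 2 * nsq X := by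
    rw [← h1]
    exact Finset.sum_le_sum_of_subset_of_nonneg (Finset.subset_univ _) fun _ _ _ => nsq_nonneg _
  have h9 : nsq X ≤ ((m : ℝ) ^ 2 * ∑ j ∈ s, nsq (Z j) +
      ((m : ℝ) ^ 2)⁻¹ * ∑ j ∈ s, nsq (emb i (B j) * X)) / 2 := by
    rw [Finset.mul_sum, Finset.mul_sum, ← Finset.sum_add_distrib, Finset.sum_div]
    exact h3.le.trans (Finset.sum_le_sum fun j _ => h4 j)
  have h10 : ((m : ℝ) ^ 2)⁻¹ * ∑ j ∈ s, nsq (emb i (B j) * X) ≤ nsq X := by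
    rw [inv_mul_le_iff₀ (by positivity)]
    exact h8
  linarith

end Basis

/-! ### Slicing coefficient functions along one coordinate. -/

section Slices

variable {n k : ℕ} [NeZero k]

/-- The coefficients of the terms whose `i`-th index is `j`, moved to index `0`. -/
def slice (i : Fin n) (j : Fin k) (Q : (Fin n → Fin k) → ℝ) : (Fin n → Fin k) → ℝ :=
  fun σ => if σ i = 0 then Q (Function.update σ i j) else 0

lemma sum_eq_sum_update {M : Type*} [AddCommMonoid M] (i : Fin n) (f : (Fin n → Fin k) → M) :
    ∑ σ, f σ = ∑ σ, if σ i = 0 then ∑ j, f (Function.update σ i j) else 0 := by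
  rw [← Finset.sum_filter, ← Finset.sum_product']
  refine Finset.sum_nbij' (fun σ => (Function.update σ i 0, σ i))
    (fun p => Function.update p.1 i p.2) ?_ ?_ ?_ ?_ ?_
  · intro σ _; simp
  · intro p _; simp
  · intro σ _; simp
  · rintro ⟨σ, j⟩ h
    simp only [Finset.mem_product, Finset.mem_filter, Finset.mem_univ, true_and, and_true] at h
    simp [← h]
  · intro σ _; simp

lemma sum_sq_slice (i : Fin n) (Q : (Fin n → Fin k) → ℝ) :
    ∑ σ, Q σ ^ 2 = ∑ j, ∑ σ, slice i j Q σ ^ 2 := by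
  rw [sum_eq_sum_update i, Finset.sum_comm]
  refine Finset.sum_congr rfl fun σ _ => ?_
  by_cases h : σ i = 0 <;> simp [slice, h]

lemma weight_update (i : Fin n) {j : Fin k} (hj : j ≠ 0) {σ : Fin n → Fin k} (hσ : σ i = 0) :
    weight (Function.update σ i j) = weight σ + 1 := by
  have : (Finset.univ.filter fun l => Function.update σ i j l ≠ 0) =
      insert i (Finset.univ.filter fun l => σ l ≠ 0) := by
    ext l
    rcases eq_or_ne l i with rfl | h <;> simp [*]
  rw [weight, this, Finset.card_insert_of_notMem (by simp [hσ]), weight]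

lemma slice_zero_noiseOp (i : Fin n) (γ : ℝ) (Q : (Fin n → Fin k) → ℝ) :
    slice i 0 (noiseOp γ Q) = noiseOp γ (slice i 0 Q) := by
  ext σ
  by_cases h : σ i = 0
  · have : Function.update σ i 0 = σ := by rw [← h]; simp
    simp [slice, noiseOp, h, this]
  · simp [slice, noiseOp, h]

/-- Moving the index `j ≠ 0` to `0` lowers the weight by one, hence the extra factor `γ`. -/
lemma slice_noiseOp (i : Fin n) {j : Fin k} (hj : j ≠ 0) (γ : ℝ) (Q : (Fin n → Fin k) → ℝ) :
    slice i j (noiseOp γ Q) = γ • noiseOp γ (slice i j Q) := by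
  ext σ
  by_cases h : σ i = 0
  · simp [slice, noiseOp, h, weight_update i hj h, pow_succ]; ring
  · simp [slice, noiseOp, h]

/-- The part of `Q` that depends on coordinate `i`. -/
def dependPart (i : Fin n) (Q : (Fin n → Fin k) → ℝ) : (Fin n → Fin k) → ℝ :=
  fun σ => if σ i = 0 then 0 else Q σ

lemma slice_zero_dependPart (i : Fin n) (Q : (Fin n → Fin k) → ℝ) :
    slice i 0 (dependPart i Q) = 0 := by
  ext σ
  simp [slice, dependPart]

lemma slice_dependPart (i : Fin n) {j : Fin k} (hj : j ≠ 0) (Q : (Fin n → Fin k) → ℝ) :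
    slice i j (dependPart i Q) = slice i j Q := by
  ext σ
  simp [slice, dependPart, hj]

end Slices

/-! ### Hybrids: operators with some registers replaced by numbers. -/

section PartialEvaluation

variable {m n : ℕ} [NeZero m] {B : Fin (m ^ 2) → Matrix (Fin m) (Fin m) ℂ}

variable (B) in
/-- The operator obtained from `∑ Q̂(σ) B_σ` by substituting the numbers `v i j` for the basis
elements in the registers of `S`. -/
def partialEval (S : Finset (Fin n)) (Q : (Fin n → Fin (m ^ 2)) → ℝ)
    (v : Fin n → Fin (m ^ 2) → ℝ) : Matrix (Fin n → Fin m) (Fin n → Fin m) ℂ :=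
  ∑ σ, (Q σ * ∏ k ∈ S, v k (σ k)) • tensorBasis B (S.piecewise 0 σ)

lemma partialEval_zero (S : Finset (Fin n)) (v : Fin n → Fin (m ^ 2) → ℝ) :
    partialEval B S 0 v = 0 := by
  simp [partialEval]

lemma partialEval_smul (S : Finset (Fin n)) (c : ℝ) (Q : (Fin n → Fin (m ^ 2)) → ℝ)
    (v : Fin n → Fin (m ^ 2) → ℝ) : partialEval B S (c • Q) v = c • partialEval B S Q v := by
  simp [partialEval, Finset.smul_sum, smul_smul, mul_assoc]

lemma partialEval_isHermitian (hB : IsStandardOrthonormalBasis B) (S : Finset (Fin n))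
    (Q : (Fin n → Fin (m ^ 2)) → ℝ) (v : Fin n → Fin (m ^ 2) → ℝ) :
    (partialEval B S Q v).IsHermitian := by
  rw [Matrix.IsHermitian, partialEval, Matrix.conjTranspose_sum]
  refine Finset.sum_congr rfl fun σ _ => ?_
  rw [Matrix.conjTranspose_smul, (tensorBasis_isHermitian hB _).eq, star_trivial]

lemma partialEval_congr {S : Finset (Fin n)} (Q : (Fin n → Fin (m ^ 2)) → ℝ)
    {v w : Fin n → Fin (m ^ 2) → ℝ} (h : ∀ i ∈ S, v i = w i) :
    partialEval B S Q v = partialEval B S Q w := by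
  refine Finset.sum_congr rfl fun σ _ => ?_
  rw [Finset.prod_congr rfl fun k hk => by rw [h k hk]]

lemma continuous_partialEval (S : Finset (Fin n)) (Q : (Fin n → Fin (m ^ 2)) → ℝ) :
    Continuous (partialEval B S Q) := by
  unfold partialEval
  fun_prop

lemma emb_mul_tensorBasis (hB : IsStandardOrthonormalBasis B) {i : Fin n} {σ : Fin n → Fin (m ^ 2)}
    (h : σ i = 0) (j : Fin (m ^ 2)) :
    emb i (B j) * tensorBasis B σ = tensorBasis B (Function.update σ i j) := by
  rw [emb, tensorBasis_eq_tens, tens_mul, tensorBasis_eq_tens]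
  congr 1
  ext1 k
  rcases eq_or_ne k i with rfl | hk
  · simp [h, hB.zero_eq_one]
  · simp [hk]

lemma tensorBasis_mul_emb (hB : IsStandardOrthonormalBasis B) {i : Fin n} {σ : Fin n → Fin (m ^ 2)}
    (h : σ i = 0) (j : Fin (m ^ 2)) :
    tensorBasis B σ * emb i (B j) = tensorBasis B (Function.update σ i j) := by
  rw [emb, tensorBasis_eq_tens, tens_mul, tensorBasis_eq_tens]
  congr 1
  ext1 k
  rcases eq_or_ne k i with rfl | hk
  · simp [h, hB.zero_eq_one]
  · simp [hk]

/-- A slice has index `0` in register `i`, where the basis matrix is the identity. Commuting with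
every `emb i (B k)` is how triviality on register `i` is expressed throughout; it passes to products
and to resolvents. -/
lemma commute_emb_partialEval_slice (hB : IsStandardOrthonormalBasis B) (i : Fin n)
    (S : Finset (Fin n)) (j k : Fin (m ^ 2)) (Q : (Fin n → Fin (m ^ 2)) → ℝ)
    (v : Fin n → Fin (m ^ 2) → ℝ) :
    Commute (emb i (B k)) (partialEval B S (slice i j Q) v) := by
  refine Commute.sum_right _ _ _ fun σ _ => ?_
  by_cases h : σ i = 0
  · have h' : S.piecewise 0 σ i = 0 := by
      by_cases hi : i ∈ S <;> simp [hi, h]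
    refine Commute.smul_right ?_ _
    exact (emb_mul_tensorBasis hB h' k).trans (tensorBasis_mul_emb hB h' k).symm
  · simp [slice, h]

/-- Expansion of a partial evaluation along a register that is kept. -/
lemma partialEval_eq_sum_emb (hB : IsStandardOrthonormalBasis B) {i : Fin n} {S : Finset (Fin n)}
    (hi : i ∉ S) (Q : (Fin n → Fin (m ^ 2)) → ℝ) (v : Fin n → Fin (m ^ 2) → ℝ) :
    partialEval B S Q v = ∑ j, emb i (B j) * partialEval B S (slice i j Q) v := by
  simp only [partialEval, Finset.mul_sum]
  rw [sum_eq_sum_update i, Finset.sum_comm]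
  refine Finset.sum_congr rfl fun σ _ => ?_
  by_cases h : σ i = 0
  · rw [if_pos h]
    refine Finset.sum_congr rfl fun j _ => ?_
    have h1 : S.piecewise (0 : Fin n → Fin (m ^ 2)) (Function.update σ i j) =
        Function.update (S.piecewise 0 σ) i j := by
      ext1 k
      rcases eq_or_ne k i with rfl | hk
      · simp [hi]
      · by_cases hkS : k ∈ S <;> simp [hk, hkS]
    have h2 : ∏ k ∈ S, v k (Function.update σ i j k) = ∏ k ∈ S, v k (σ k) :=
      Finset.prod_congr rfl fun k hk => by
        rw [Function.update_of_ne (ne_of_mem_of_not_mem hk hi)]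
    rw [h1, h2, mul_smul_comm, emb_mul_tensorBasis hB (by simp [hi, h]), slice, if_pos h]
  · simp [slice, h]

/-- Expansion of a partial evaluation along a register that is substituted. -/
lemma partialEval_insert {i : Fin n} {S : Finset (Fin n)}
    (hi : i ∉ S) (Q : (Fin n → Fin (m ^ 2)) → ℝ) (v : Fin n → Fin (m ^ 2) → ℝ) :
    partialEval B (insert i S) Q v = ∑ j, v i j • partialEval B S (slice i j Q) v := by
  simp only [partialEval, Finset.smul_sum]
  rw [sum_eq_sum_update i, Finset.sum_comm]
  refine Finset.sum_congr rfl fun σ _ => ?_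
  by_cases h : σ i = 0
  · rw [if_pos h]
    refine Finset.sum_congr rfl fun j _ => ?_
    have h1 : (insert i S).piecewise (0 : Fin n → Fin (m ^ 2)) (Function.update σ i j) =
        S.piecewise 0 σ := by
      ext1 k
      rcases eq_or_ne k i with rfl | hk
      · simp [hi, h]
      · by_cases hkS : k ∈ S <;> simp [hk, hkS]
    have h2 : ∏ k ∈ S, v k (Function.update σ i j k) = ∏ k ∈ S, v k (σ k) :=
      Finset.prod_congr rfl fun k hk => by
        rw [Function.update_of_ne (ne_of_mem_of_not_mem hk hi)]
    rw [h1, Finset.prod_insert hi, h2, slice, if_pos h, smul_smul, Function.update_self]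
    congr 1
    ring
  · simp [slice, h]

end PartialEvaluation

/-! ### Fourth moment of a sum of two Hermitian matrices. -/

section FourthMoment

lemma nsq_smul {κ : Type*} [Fintype κ] (c : ℝ) (Y : Matrix κ κ ℂ) : nsq (c • Y) = c ^ 2 * nsq Y := by
  simp only [nsq, Matrix.conjTranspose_smul, star_trivial, smul_mul_assoc, mul_smul_comm, ntr_smul]
  ring

lemma nsq_eq_of_isHermitian {κ : Type*} [Fintype κ] {X : Matrix κ κ ℂ} (hX : X.IsHermitian) :
    nsq X = ntr (X * X) := by rw [nsq, hX.eq]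

/-- Of the sixteen words in `A` and `R`, the four with a single `R` vanish by cyclicity, the six
with two are each at most `nsq (A * R)`, and the four with three are each at most half of `nsq (A *
R) + nsq (R * R)`. Thus `8 = 6 + 2` and `3 = 1 + 2`. -/
lemma nsq_add_mul_add_le {κ : Type*} [Fintype κ] {A R : Matrix κ κ ℂ} (hA : A.IsHermitian)
    (hR : R.IsHermitian) (h0 : ntr (A * A * A * R) = 0) :
    nsq ((A + R) * (A + R)) ≤ nsq (A * A) + 8 * nsq (A * R) + 3 * nsq (R * R) := by
  have e1 : nsq (A * A) = ntr (A * A * A * A) := by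
    rw [nsq, Matrix.conjTranspose_mul, hA.eq]; noncomm_ring
  have e2 : nsq (R * R) = ntr (R * R * R * R) := by
    rw [nsq, Matrix.conjTranspose_mul, hR.eq]; noncomm_ring
  have e3 : nsq (A * R) = ntr (R * A * A * R) := by
    rw [nsq, Matrix.conjTranspose_mul, hR.eq, hA.eq]; noncomm_ring
  have c1 : ntr (A * A * R * A) = 0 := by
    rw [ntr_mul_comm, ← h0]; noncomm_ring
  have c2 : ntr (A * R * A * A) = 0 := by
    rw [ntr_mul_comm, ← c1]; noncomm_ring
  have c3 : ntr (R * A * A * A) = 0 := by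
    rw [ntr_mul_comm, ← c2]; noncomm_ring
  have d1 : ntr (R * R * A * A) = ntr (R * A * A * R) := by
    rw [show R * R * A * A = R * (R * A * A) by noncomm_ring, ntr_mul_comm]
  have d2 : ntr (A * R * R * A) = ntr (R * A * A * R) := by
    rw [ntr_mul_comm, ← d1, show A * (A * R * R) = (A * A) * (R * R) by noncomm_ring,
      ntr_mul_comm]
    noncomm_ring
  have d3 : ntr (A * A * R * R) = ntr (R * A * A * R) := by
    rw [ntr_mul_comm]; noncomm_ring
  have f1 : ntr (A * R * A * R) ≤ ntr (R * A * A * R) := by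
    have h := two_mul_abs_ntr_mul_le (A * R) (A * R)
    rw [e3, show A * R * (A * R) = A * R * A * R by noncomm_ring] at h
    have := le_abs_self (ntr (A * R * A * R))
    linarith
  have f2 : ntr (R * A * R * A) = ntr (A * R * A * R) := by
    rw [ntr_mul_comm]; noncomm_ring
  have g1 : 2 * ntr (A * R * R * R) ≤ ntr (R * A * A * R) + ntr (R * R * R * R) := by
    have h := two_mul_abs_ntr_mul_le (A * R) (R * R)
    rw [e3, e2, show A * R * (R * R) = A * R * R * R by noncomm_ring] at h
    have := le_abs_self (ntr (A * R * R * R))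
    linarith
  have g2 : ntr (R * R * R * A) = ntr (A * R * R * R) := by
    rw [ntr_mul_comm]; noncomm_ring
  have g3 : ntr (R * R * A * R) = ntr (A * R * R * R) := by
    rw [← g2, ntr_mul_comm]; noncomm_ring
  have g4 : ntr (R * A * R * R) = ntr (A * R * R * R) := by
    rw [← g3, ntr_mul_comm]; noncomm_ring
  have key : nsq ((A + R) * (A + R)) = ntr (A * A * A * A) + ntr (A * A * A * R) +
      ntr (A * A * R * A) + ntr (A * R * A * A) + ntr (R * A * A * A) + ntr (A * A * R * R) +
      ntr (A * R * A * R) + ntr (A * R * R * A) + ntr (R * A * A * R) + ntr (R * A * R * A) +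
      ntr (R * R * A * A) + ntr (A * R * R * R) + ntr (R * A * R * R) + ntr (R * R * A * R) +
      ntr (R * R * R * A) + ntr (R * R * R * R) := by
    rw [nsq, Matrix.conjTranspose_mul, (hA.add hR).eq]
    simp only [← ntr_add]
    congr 1
    noncomm_ring
  rw [key, e1, e2, e3]
  linarith

lemma ntr_mul_self_mul_mul_self_le {κ : Type*} [Fintype κ] {X Y : Matrix κ κ ℂ} {a b : ℝ}
    (ha : 0 ≤ a) (hb : 0 ≤ b) (hX : nsq (X * X) ≤ a ^ 2) (hY : nsq (Y * Y) ≤ b ^ 2) :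
    ntr ((X * X) * (Y * Y)) ≤ a * b := by
  refine (abs_le_of_sq_le_sq' ((ntr_mul_sq_le _ _).trans ?_) (by positivity)).2
  rw [mul_pow]
  exact mul_le_mul hX hY (nsq_nonneg _) (by positivity)

end FourthMoment

/-! ### Noncommutative hypercontractivity. -/

section Hypercontractivity

variable {m n : ℕ} [NeZero m] {B : Fin (m ^ 2) → Matrix (Fin m) (Fin m) ℂ}

/-- Contraction of a repeated sum over the basis elements of one register. -/
lemma ntr_mul_sum_emb_mul_sum_emb (hB : IsStandardOrthonormalBasis B) (i : Fin n)
    {D E : Matrix (Fin n → Fin m) (Fin n → Fin m) ℂ}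
    {C : Fin (m ^ 2) → Matrix (Fin n → Fin m) (Fin n → Fin m) ℂ}
    (hD : ∀ k, Commute (emb i (B k)) D) (hE : ∀ k, Commute (emb i (B k)) E)
    (hC : ∀ k j, Commute (emb i (B k)) (C j)) (s : Finset (Fin (m ^ 2))) :
    ntr (D * (∑ j ∈ s, emb i (B j) * C j) * E * ∑ j ∈ s, emb i (B j) * C j) =
      ∑ j ∈ s, ntr (D * C j * E * C j) := by
  have h : ∀ j l, ntr (D * (emb i (B j) * C j) * E * (emb i (B l) * C l)) =
      if j = l then ntr (D * C j * E * C l) else 0 := by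
    intro j l
    have h1 : D * (emb i (B j) * C j) * E * (emb i (B l) * C l) =
        emb i (B j * B l) * (D * C j * E * C l) := by
      rw [← emb_mul]
      calc D * (emb i (B j) * C j) * E * (emb i (B l) * C l)
          = (D * emb i (B j)) * (C j * E * emb i (B l)) * C l := by noncomm_ring
        _ = (emb i (B j) * D) * (emb i (B l) * (C j * E)) * C l := by
          rw [(hD j).eq, ((hC l j).mul_right (hE l)).eq]
        _ = emb i (B j) * (D * emb i (B l)) * (C j * E) * C l := by noncomm_ring
        _ = emb i (B j) * (emb i (B l) * D) * (C j * E) * C l := by rw [(hD l).eq]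
        _ = _ := by noncomm_ring
    rw [h1, ntr_mul_comm, ntr_mul_emb hB i
      fun k => (((hD k).mul_right (hC k j)).mul_right (hE k)).mul_right (hC k l)]
  simp only [Finset.mul_sum, Finset.sum_mul, ntr_sum, h]
  simp

/-- The matrices `B j` with `j ≠ 0` are traceless. This is the matrix counterpart of centred
variables. -/
lemma ntr_mul_sum_emb_eq_zero (hB : IsStandardOrthonormalBasis B) (i : Fin n)
    {D : Matrix (Fin n → Fin m) (Fin n → Fin m) ℂ}
    {C : Fin (m ^ 2) → Matrix (Fin n → Fin m) (Fin n → Fin m) ℂ}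
    (hD : ∀ k, Commute (emb i (B k)) D)
    (hC : ∀ k j, Commute (emb i (B k)) (C j)) {s : Finset (Fin (m ^ 2))} (hs : 0 ∉ s) :
    ntr (D * ∑ j ∈ s, emb i (B j) * C j) = 0 := by
  rw [Finset.mul_sum, ntr_sum]
  refine Finset.sum_eq_zero fun j hj => ?_
  rw [(hC j j).eq, ← mul_assoc]
  exact ntr_mul_emb_single hB i (fun k => (hD k).mul_right (hC k j))
    (ne_of_mem_of_not_mem hj hs)

lemma isHermitian_sum_emb_mul (hB : IsStandardOrthonormalBasis B) (i : Fin n)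
    {C : Fin (m ^ 2) → Matrix (Fin n → Fin m) (Fin n → Fin m) ℂ}
    (hCh : ∀ j, (C j).IsHermitian) (hC : ∀ k j, Commute (emb i (B k)) (C j))
    (s : Finset (Fin (m ^ 2))) : (∑ j ∈ s, emb i (B j) * C j).IsHermitian := by
  rw [Matrix.IsHermitian, Matrix.conjTranspose_sum]
  refine Finset.sum_congr rfl fun j _ => ?_
  rw [Matrix.conjTranspose_mul, (hCh j).eq, (emb_isHermitian i (hB.hermitian j)).eq, (hC j j).eq]

/-- One factor of the square is peeled off at the price `m²` by `nsq_sum_emb_mul_le`; in what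
remains, orthogonality in register `i` leaves only diagonal terms. The factor `m²` meets `γ⁴` in the
induction, so noise of size `m^(-1/2)` suffices. -/
lemma nsq_sum_emb_mul_self_le (hB : IsStandardOrthonormalBasis B) (i : Fin n)
    {C : Fin (m ^ 2) → Matrix (Fin n → Fin m) (Fin n → Fin m) ℂ}
    (hCh : ∀ j, (C j).IsHermitian) (hC : ∀ k j, Commute (emb i (B k)) (C j))
    {c : Fin (m ^ 2) → ℝ} (hc : ∀ j, 0 ≤ c j) (hle : ∀ j, nsq (C j * C j) ≤ c j ^ 2)
    (s : Finset (Fin (m ^ 2))) :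
    nsq ((∑ j ∈ s, emb i (B j) * C j) * ∑ j ∈ s, emb i (B j) * C j) ≤
      (m : ℝ) ^ 2 * (∑ j ∈ s, c j) ^ 2 := by
  set R := ∑ j ∈ s, emb i (B j) * C j with hR
  have hRh : R.IsHermitian := isHermitian_sum_emb_mul hB i hCh hC s
  have h1 : R * R = ∑ j ∈ s, emb i (B j) * (C j * R) := by
    conv_lhs => enter [1]; rw [hR]
    rw [Finset.sum_mul]
    simp only [mul_assoc]
  rw [h1]
  refine (nsq_sum_emb_mul_le hB i s _).trans ?_
  gcongr
  have h2 : ∀ j, nsq (C j * R) ≤ c j * ∑ l ∈ s, c l := by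
    intro j
    have h3 : nsq (C j * R) = ntr ((C j * C j) * R * 1 * R) := by
      rw [nsq, Matrix.conjTranspose_mul, (hCh j).eq, hRh.eq, mul_assoc, ntr_mul_comm]
      noncomm_ring
    rw [h3, ntr_mul_sum_emb_mul_sum_emb hB i (fun k => (hC k j).mul_right (hC k j))
      (fun k => Commute.one_right _) hC s, Finset.mul_sum]
    refine Finset.sum_le_sum fun l _ => ?_
    rw [mul_one, mul_assoc]
    exact ntr_mul_self_mul_mul_self_le (hc j) (hc l) (hle j) (hle l)
  calc ∑ j ∈ s, nsq (C j * R) ≤ ∑ j ∈ s, c j * ∑ l ∈ s, c l :=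
        Finset.sum_le_sum fun j _ => h2 j
    _ = _ := by rw [← Finset.sum_mul]; ring

lemma partialEval_empty_noiseOp_eq_add (hB : IsStandardOrthonormalBasis B) (i : Fin n) (γ : ℝ)
    (Q : (Fin n → Fin (m ^ 2)) → ℝ) (v : Fin n → Fin (m ^ 2) → ℝ) :
    partialEval B ∅ (noiseOp γ Q) v = partialEval B ∅ (noiseOp γ (slice i 0 Q)) v +
      γ • ∑ j ∈ Finset.univ.erase 0, emb i (B j) * partialEval B ∅ (noiseOp γ (slice i j Q)) v := by
  rw [partialEval_eq_sum_emb hB (Finset.notMem_empty i),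
    ← Finset.add_sum_erase _ _ (Finset.mem_univ (0 : Fin (m ^ 2))), hB.zero_eq_one, emb_one,
    one_mul, slice_zero_noiseOp, Finset.smul_sum]
  congr 1
  refine Finset.sum_congr rfl fun j hj => ?_
  rw [slice_noiseOp i (Finset.ne_of_mem_erase hj), partialEval_smul, mul_smul_comm]

/-- Commutation survives the noise operator, since noise preserves being a slice. -/
lemma commute_emb_partialEval_noiseOp_slice (hB : IsStandardOrthonormalBasis B) (i : Fin n)
    (j k : Fin (m ^ 2)) (γ : ℝ) (Q : (Fin n → Fin (m ^ 2)) → ℝ)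
    (v : Fin n → Fin (m ^ 2) → ℝ) :
    Commute (emb i (B k)) (partialEval B ∅ (noiseOp γ (slice i j Q)) v) := by
  have : noiseOp γ (slice i j Q) = slice i 0 (noiseOp γ (slice i j Q)) := by
    ext σ
    by_cases h : σ i = 0
    · have h2 : Function.update σ i 0 = σ := by rw [← h]; simp
      simp [slice, noiseOp, h, h2]
    · simp [slice, noiseOp, h]
  rw [this]
  exact commute_emb_partialEval_slice hB i ∅ 0 k _ v

/-- Induction on the set `T` of registers on which `Q` may depend. Splitting off register `i` as `A
+ γ R`, with coefficient masses `c 0` and `r`, the fourth moment is at most `c₀² + 8γ² c₀ r + 3γ⁴ m²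
r²`, and this is at most `(c₀ + r)²` when `9mγ² ≤ 1`. -/
lemma nsq_partialEval_noiseOp_le_aux (hB : IsStandardOrthonormalBasis B) {γ : ℝ}
    (hγ : 9 * m * γ ^ 2 ≤ 1) (T : Finset (Fin n)) (v : Fin n → Fin (m ^ 2) → ℝ) :
    ∀ Q : (Fin n → Fin (m ^ 2)) → ℝ, (∀ σ, Q σ ≠ 0 → ∀ i ∉ T, σ i = 0) →
    nsq (partialEval B ∅ (noiseOp γ Q) v * partialEval B ∅ (noiseOp γ Q) v) ≤
      (∑ σ, Q σ ^ 2) ^ 2 := by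
  have hm : 1 ≤ (m : ℝ) := by exact_mod_cast NeZero.one_le
  induction T using Finset.induction_on with
  | empty =>
    intro Q hQ
    have h1 : ∀ σ, σ ≠ 0 → Q σ = 0 := by
      intro σ hσ
      by_contra h
      exact hσ (funext fun i => hQ σ h i (Finset.notMem_empty i))
    have h2 : partialEval B ∅ (noiseOp γ Q) v = Q 0 • 1 := by
      rw [partialEval, Finset.sum_eq_single 0]
      · simp [noiseOp, weight, tensorBasis_eq_tens, hB.zero_eq_one, tens_one]
      · intro σ _ hσ
        simp [noiseOp, h1 σ hσ]
      · simp
    rw [h2, Finset.sum_eq_single 0 (fun σ _ hσ => by simp [h1 σ hσ]) (by simp), smul_mul_smul,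
      nsq_smul, mul_one]
    simp only [nsq, Matrix.conjTranspose_one, mul_one, ntr_one]
    exact (by ring : _ = _).le
  | insert i T hi ih =>
    intro Q hQ
    have hsl : ∀ j σ, slice i j Q σ ≠ 0 → ∀ l ∉ T, σ l = 0 := by
      intro j σ hσ l hl
      by_cases h : σ i = 0
      · rcases eq_or_ne l i with rfl | hli
        · exact h
        · have := hQ _ (by simpa [slice, h] using hσ) l (by simp [hli, hl])
          simpa [hli] using this
      · simp [slice, h] at hσ
    set A := partialEval B ∅ (noiseOp γ (slice i 0 Q)) v with hA
    set C := fun j => partialEval B ∅ (noiseOp γ (slice i j Q)) v with hC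
    set R := ∑ j ∈ Finset.univ.erase 0, emb i (B j) * C j with hR
    have hcomm : ∀ k j, Commute (emb i (B k)) (C j) := fun k j =>
      commute_emb_partialEval_noiseOp_slice hB i j k γ Q v
    have hCh : ∀ j, (C j).IsHermitian := fun j => partialEval_isHermitian hB _ _ _
    have hAh : A.IsHermitian := hCh 0
    have hAc : ∀ k, Commute (emb i (B k)) A := fun k => hcomm k 0
    have hRh : R.IsHermitian := isHermitian_sum_emb_mul hB i hCh hcomm _
    set c : Fin (m ^ 2) → ℝ := fun j => ∑ σ, slice i j Q σ ^ 2 with hc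
    have hc0 : ∀ j, 0 ≤ c j := fun j => Finset.sum_nonneg fun _ _ => sq_nonneg _
    have hle : ∀ j, nsq (C j * C j) ≤ c j ^ 2 := fun j => ih (slice i j Q) (hsl j)
    set r := ∑ j ∈ Finset.univ.erase (0 : Fin (m ^ 2)), c j with hr
    have hr0 : 0 ≤ r := Finset.sum_nonneg fun j _ => hc0 j
    have hQsum : ∑ σ, Q σ ^ 2 = c 0 + r := by
      rw [sum_sq_slice i, hr, Finset.add_sum_erase _ _ (Finset.mem_univ _)]
    have e : partialEval B ∅ (noiseOp γ Q) v = A + γ • R := partialEval_empty_noiseOp_eq_add hB i γ Q v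
    have hγR : (γ • R).IsHermitian := by
      rw [Matrix.IsHermitian, Matrix.conjTranspose_smul, hRh.eq, star_trivial]
    have h0 : ntr (A * A * A * (γ • R)) = 0 := by
      rw [mul_smul_comm, ntr_smul, ntr_mul_sum_emb_eq_zero hB i
        (fun k => ((hAc k).mul_right (hAc k)).mul_right (hAc k)) hcomm (by simp), mul_zero]
    have h1 := nsq_add_mul_add_le hAh hγR h0
    have h2 : nsq (A * R) ≤ c 0 * r := by
      have h3 : nsq (A * R) = ntr ((A * A) * R * 1 * R) := by
        rw [nsq, Matrix.conjTranspose_mul, hAh.eq, hRh.eq, mul_assoc, ntr_mul_comm]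
        noncomm_ring
      rw [h3, ntr_mul_sum_emb_mul_sum_emb hB i (fun k => (hAc k).mul_right (hAc k))
        (fun k => Commute.one_right _) hcomm, hr, Finset.mul_sum]
      refine Finset.sum_le_sum fun l _ => ?_
      rw [mul_one, mul_assoc]
      exact ntr_mul_self_mul_mul_self_le (hc0 0) (hc0 l) (hle 0) (hle l)
    have h4 : nsq (R * R) ≤ (m : ℝ) ^ 2 * r ^ 2 := nsq_sum_emb_mul_self_le hB i hCh hcomm hc0 hle _
    rw [e, hQsum]
    rw [mul_smul_comm, smul_mul_smul, nsq_smul, nsq_smul] at h1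
    have hγ0 := sq_nonneg γ
    have hγ1 : 9 * γ ^ 2 ≤ 1 := by nlinarith
    have hγ2 : (9 * m * γ ^ 2) ^ 2 ≤ 1 := pow_le_one₀ (by positivity) hγ
    have h5 : nsq (A * A) ≤ c 0 ^ 2 := hle 0
    have h6 : γ ^ 2 * nsq (A * R) ≤ γ ^ 2 * (c 0 * r) := mul_le_mul_of_nonneg_left h2 hγ0
    have h7 : (γ * γ) ^ 2 * nsq (R * R) ≤ (γ * γ) ^ 2 * ((m : ℝ) ^ 2 * r ^ 2) :=
      mul_le_mul_of_nonneg_left h4 (sq_nonneg _)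
    have h8 : 9 * γ ^ 2 * (c 0 * r) ≤ 1 * (c 0 * r) :=
      mul_le_mul_of_nonneg_right hγ1 (mul_nonneg (hc0 0) hr0)
    have h9 : (9 * m * γ ^ 2) ^ 2 * r ^ 2 ≤ 1 * r ^ 2 :=
      mul_le_mul_of_nonneg_right hγ2 (sq_nonneg _)
    have h10 : 0 ≤ c 0 * r := mul_nonneg (hc0 0) hr0
    nlinarith

/-- Hypercontractivity of the noise operator on matrices. -/
lemma nsq_partialEval_noiseOp_le (hB : IsStandardOrthonormalBasis B) {γ : ℝ}
    (hγ : 9 * m * γ ^ 2 ≤ 1) (v : Fin n → Fin (m ^ 2) → ℝ) (Q : (Fin n → Fin (m ^ 2)) → ℝ) :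
    nsq (partialEval B ∅ (noiseOp γ Q) v * partialEval B ∅ (noiseOp γ Q) v) ≤
      (∑ σ, Q σ ^ 2) ^ 2 :=
  nsq_partialEval_noiseOp_le_aux hB hγ Finset.univ v Q fun _ _ i hi => absurd (Finset.mem_univ i) hi

end Hypercontractivity

/-! ### Moments and independence for scalar ensembles. -/

section Ensemble

variable {k n : ℕ} [NeZero k] {Ω : Type*} [MeasurableSpace Ω] {μ : Measure Ω}
  {x : Fin n → Fin k → Ω → ℝ}

/-- The Cauchy-Schwarz inequality for integrals of real functions. -/
lemma sq_integral_mul_le {Ω : Type*} [MeasurableSpace Ω] {μ : Measure Ω} {f g : Ω → ℝ}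
    (hf : MemLp f 2 μ) (hg : MemLp g 2 μ) :
    (∫ ω, f ω * g ω ∂μ) ^ 2 ≤ (∫ ω, f ω ^ 2 ∂μ) * ∫ ω, g ω ^ 2 ∂μ := by
  have hfg : Integrable (fun ω => f ω * g ω) μ := hf.integrable_mul hg
  have h : ∀ t : ℝ, 0 ≤ (∫ ω, g ω ^ 2 ∂μ) * (t * t) + (2 * ∫ ω, f ω * g ω ∂μ) * t +
      ∫ ω, f ω ^ 2 ∂μ := by
    intro t
    have h1 : 0 ≤ ∫ ω, (t * t) * g ω ^ 2 + ((2 * t) * (f ω * g ω) + f ω ^ 2) ∂μ :=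
      integral_nonneg fun ω => by
        have : (t * t) * g ω ^ 2 + ((2 * t) * (f ω * g ω) + f ω ^ 2) = (f ω + t * g ω) ^ 2 := by
          ring
        rw [this]
        positivity
    have h2 : Integrable (fun ω => (2 * t) * (f ω * g ω) + f ω ^ 2) μ :=
      (hfg.const_mul _).add hf.integrable_sq
    rw [integral_add (hg.integrable_sq.const_mul _) h2,
      integral_add (hfg.const_mul _) hf.integrable_sq,
      integral_const_mul, integral_const_mul] at h1
    linarith
  have := discrim_le_zero h
  rw [discrim] at this
  nlinarith

lemma IsEnsemble.integral_prod_mul_prod (hx : IsEnsemble x μ) (σ τ : Fin n → Fin k) :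
    ∫ ω, (∏ i, x i (σ i) ω) * ∏ i, x i (τ i) ω ∂μ = if σ = τ then 1 else 0 := by
  have h := hx.indep.integral_fun_prod_comp
    (f := fun i (u : Fin k → ℝ) => u (σ i) * u (τ i))
    (fun i => (measurable_pi_lambda _ fun j => hx.measurable i j).aemeasurable)
    (fun i => by fun_prop)
  simp only [← Finset.prod_mul_distrib, h, hx.orthonormal]
  simp only [Finset.prod_ite_zero, Finset.mem_univ, forall_true_left, funext_iff,
    Finset.prod_const_one]

lemma IsEnsemble.measurable_prod (hx : IsEnsemble x μ) (σ : Fin n → Fin k) :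
    Measurable fun ω => ∏ i, x i (σ i) ω :=
  Finset.measurable_prod _ fun i _ => hx.measurable i (σ i)

lemma IsEnsemble.memLp_two_prod (hx : IsEnsemble x μ) (σ : Fin n → Fin k) :
    MemLp (fun ω => ∏ i, x i (σ i) ω) 2 μ := by
  rw [memLp_two_iff_integrable_sq (hx.measurable_prod σ).aestronglyMeasurable]
  -- A nonintegrable function has integral `0` by convention, so the value `1` already forces
  -- integrability.
  refine integrable_of_integral_eq_one ?_
  simp only [sq, hx.integral_prod_mul_prod, if_true]

lemma IsEnsemble.memLp_two_multilinearEval (hx : IsEnsemble x μ) (Q : (Fin n → Fin k) → ℝ) :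
    MemLp (multilinearEval x Q) 2 μ := by
  unfold multilinearEval
  exact memLp_finsetSum _ fun τ _ => (hx.memLp_two_prod τ).const_mul (Q τ)

lemma IsEnsemble.integral_multilinearEval_sq (hx : IsEnsemble x μ) (Q : (Fin n → Fin k) → ℝ) :
    ∫ ω, multilinearEval x Q ω ^ 2 ∂μ = ∑ τ, Q τ ^ 2 := by
  have hint : ∀ σ τ, Integrable
      (fun ω => Q σ * Q τ * ((∏ i, x i (σ i) ω) * ∏ i, x i (τ i) ω)) μ := fun σ τ =>
    ((hx.memLp_two_prod σ).integrable_mul (hx.memLp_two_prod τ)).const_mul _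
  calc ∫ ω, multilinearEval x Q ω ^ 2 ∂μ
      = ∫ ω, ∑ σ, ∑ τ, Q σ * Q τ * ((∏ i, x i (σ i) ω) * ∏ i, x i (τ i) ω) ∂μ := by
        congr 1
        ext ω
        rw [multilinearEval, sq, Finset.sum_mul_sum]
        exact Finset.sum_congr rfl fun σ _ => Finset.sum_congr rfl fun τ _ => by ring
    _ = _ := by
        rw [integral_finsetSum _ fun σ _ => integrable_finsetSum _ fun τ _ => hint σ τ]
        refine Finset.sum_congr rfl fun σ _ => ?_
        rw [integral_finsetSum _ fun τ _ => hint σ τ]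
        simp only [integral_const_mul, hx.integral_prod_mul_prod]
        simp [sq]

lemma IsEnsemble.integral_multilinearEval [IsProbabilityMeasure μ] (hx : IsEnsemble x μ) (Q : (Fin n → Fin k) → ℝ) :
    ∫ ω, multilinearEval x Q ω ∂μ = Q 0 := by
  unfold multilinearEval
  have h : ∀ τ : Fin n → Fin k, ∫ ω, ∏ i, x i (τ i) ω ∂μ = if τ = 0 then 1 else 0 := by
    intro τ
    rw [← hx.integral_prod_mul_prod τ 0]
    simp [hx.zero_eq_one]
  rw [integral_finsetSum _ fun τ _ =>
    ((hx.memLp_two_prod τ).integrable one_le_two).const_mul (Q τ)]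
  simp [integral_const_mul, h]

lemma multilinearEval_noiseOp_single {Ω : Type*} {x : Fin n → Fin k → Ω → ℝ} (γ : ℝ) (σ : Fin n → Fin k) :
    multilinearEval x (noiseOp γ (Pi.single σ 1)) =
      fun ω => γ ^ weight σ * ∏ i, x i (σ i) ω := by
  ext ω
  rw [multilinearEval, Finset.sum_eq_single σ]
  · simp [noiseOp]
  · intro τ _ hτ
    simp [noiseOp, hτ]
  · simp

/-- Hypercontractivity is applied to a single monomial, whose `L²` norm is finite; the power of `η`
is then divided out. -/
lemma IsEnsemble.memLp_four_prod (hx : IsEnsemble x μ) {η : ℝ} (hη : η ≠ 0)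
    (hh : IsHypercontractive x μ 2 4 η) (σ : Fin n → Fin k) :
    MemLp (fun ω => ∏ i, x i (σ i) ω) 4 μ := by
  have h := hh (Pi.single σ 1)
  rw [multilinearEval_noiseOp_single] at h
  have h1 : MemLp (fun ω => η ^ weight σ * ∏ i, x i (σ i) ω) 4 μ :=
    ⟨((hx.measurable_prod σ).const_mul _).aestronglyMeasurable,
      h.trans_lt (hx.memLp_two_multilinearEval _).2⟩
  have h2 := h1.const_mul (η ^ weight σ)⁻¹
  have h3 : (fun ω => (η ^ weight σ)⁻¹ * (η ^ weight σ * ∏ i, x i (σ i) ω)) =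
      fun ω => ∏ i, x i (σ i) ω := by
    ext ω
    rw [inv_mul_cancel_left₀ (pow_ne_zero _ hη)]
  rwa [h3] at h2

lemma IsEnsemble.memLp_four_multilinearEval (hx : IsEnsemble x μ) {η : ℝ} (hη : η ≠ 0)
    (hh : IsHypercontractive x μ 2 4 η) (Q : (Fin n → Fin k) → ℝ) :
    MemLp (multilinearEval x Q) 4 μ := by
  unfold multilinearEval
  exact memLp_finsetSum _ fun τ _ => (hx.memLp_four_prod hη hh τ).const_mul (Q τ)

lemma memLp_two_sq {Ω : Type*} [MeasurableSpace Ω] {μ : Measure Ω} {f : Ω → ℝ}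
    (hf : MemLp f 4 μ) : MemLp (fun ω => f ω ^ 2) 2 μ := by
  have : ENNReal.HolderTriple 4 4 2 := ⟨by
    rw [← two_mul, show (4 : ℝ≥0∞) = 2 * 2 by norm_num, ENNReal.mul_inv (by simp) (by simp),
      ← mul_assoc, ENNReal.mul_inv_cancel (by simp) (by simp), one_mul]⟩
  simpa only [sq] using! hf.mul (r := 2) hf

lemma IsEnsemble.integral_multilinearEval_noiseOp_pow_four_le (hx : IsEnsemble x μ) {η γ : ℝ}
    (hη : 0 < η) (hγ0 : 0 ≤ γ) (hγ : γ ≤ η) (hh : IsHypercontractive x μ 2 4 η)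
    (Q : (Fin n → Fin k) → ℝ) :
    ∫ ω, multilinearEval x (noiseOp γ Q) ω ^ 4 ∂μ ≤ (∑ τ, Q τ ^ 2) ^ 2 := by
  -- Noise of rate `γ ≤ η` is noise of rate `η` after noise of rate `γ / η ≤ 1`, and the latter does
  -- not increase the sum of squared coefficients.
  set Q' := noiseOp (γ / η) Q with hQ'
  have e : noiseOp γ Q = noiseOp η Q' := by
    ext τ
    simp only [noiseOp, hQ']
    rw [← mul_assoc, ← mul_pow, mul_div_cancel₀ _ hη.ne']
  have hle : ∑ τ, Q' τ ^ 2 ≤ ∑ τ, Q τ ^ 2 := by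
    refine Finset.sum_le_sum fun τ _ => ?_
    have h1 : (γ / η) ^ weight τ ≤ 1 := pow_le_one₀ (by positivity) ((div_le_one hη).mpr hγ)
    have h2 : 0 ≤ (γ / η) ^ weight τ := by positivity
    simp only [hQ', noiseOp, mul_pow]
    exact mul_le_of_le_one_left (sq_nonneg _) (pow_le_one₀ h2 h1)
  have h0 : 0 ≤ ∑ τ, Q' τ ^ 2 := Finset.sum_nonneg fun _ _ => sq_nonneg _
  have h := hh Q'
  rw [(hx.memLp_four_multilinearEval hη.ne' hh _).eLpNorm_eq_integral_rpow_norm (by simp) (by simp),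
    (hx.memLp_two_multilinearEval _).eLpNorm_eq_integral_rpow_norm (by simp) (by simp),
    ENNReal.ofReal_le_ofReal_iff (by positivity)] at h
  simp only [ENNReal.toReal_ofNat, Real.norm_eq_abs] at h
  have e4 : ∀ ω, |multilinearEval x (noiseOp η Q') ω| ^ (4 : ℝ) =
      multilinearEval x (noiseOp η Q') ω ^ 4 := by
    intro ω
    rw [show (4 : ℝ) = ((4 : ℕ) : ℝ) by norm_num, Real.rpow_natCast, Even.pow_abs (by decide)]
  have e2 : ∀ ω, |multilinearEval x Q' ω| ^ (2 : ℝ) = multilinearEval x Q' ω ^ 2 := by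
    intro ω
    rw [show (2 : ℝ) = ((2 : ℕ) : ℝ) by norm_num, Real.rpow_natCast, Even.pow_abs (by decide)]
  simp only [e4, e2, hx.integral_multilinearEval_sq] at h
  rw [e]
  set I := ∫ ω, multilinearEval x (noiseOp η Q') ω ^ 4 ∂μ with hI
  have hI0 : 0 ≤ I := integral_nonneg fun ω => by positivity
  have h4 := pow_le_pow_left₀ (Real.rpow_nonneg hI0 _) h 4
  rw [← Real.rpow_natCast, ← Real.rpow_mul hI0, ← Real.rpow_natCast, ← Real.rpow_mul h0] at h4
  norm_num at h4
  exact h4.trans (pow_le_pow_left₀ h0 hle 2)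

/-- The values at index `i ∉ S` are independent of any function of the values at indices in `S`. -/
lemma IsEnsemble.indepFun_of_notMem (hx : IsEnsemble x μ) {S : Finset (Fin n)} {i : Fin n}
    (hi : i ∉ S) {F : (Fin n → Fin k → ℝ) → ℝ} (hF : Measurable F)
    (hFS : ∀ v w : Fin n → Fin k → ℝ, (∀ l ∈ S, v l = w l) → F v = F w)
    {f : (Fin k → ℝ) → ℝ} (hf : Measurable f) :
    IndepFun (fun ω => F fun l j => x l j ω) (fun ω => f fun j => x i j ω) μ := by
  have h := hx.indep.indepFun_finset S {i} (by simpa using hi)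
    fun l => measurable_pi_lambda _ fun j => hx.measurable l j
  -- As `F` ignores the coordinates off `S`, filling them with `0` exhibits `F` as a function of the
  -- block indexed by `S`.
  let ext : (S → Fin k → ℝ) → Fin n → Fin k → ℝ := fun u l => if hl : l ∈ S then u ⟨l, hl⟩ else 0
  have hext : Measurable ext := by
    refine measurable_pi_lambda _ fun l => ?_
    by_cases hl : l ∈ S
    · simp only [ext, hl, dif_pos]
      exact measurable_pi_apply _
    · simp only [ext, hl, dif_neg, not_false_eq_true]
      exact measurable_const
  have h2 := h.comp (hF.comp hext)
    (hf.comp (measurable_pi_apply (⟨i, Finset.mem_singleton_self i⟩ : ({i} : Finset (Fin n)))))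
  have e : (fun ω => F fun l j => x l j ω) =
      (F ∘ ext) ∘ fun ω (l : S) j => x l j ω := by
    ext ω
    refine hFS _ _ fun l hl => ?_
    simp [ext, hl]
  rw [e]
  exact h2

end Ensemble

/-! ### Splitting multi-indices into kept and substituted coordinates. -/

section Fibers

variable {k n : ℕ} [NeZero k]

/-- The coefficients of the polynomial in the variables of `S` that multiplies `B_ρ`, when `ρ`
vanishes on `S`. -/
def fiberCoeff (S : Finset (Fin n)) (Q : (Fin n → Fin k) → ℝ) (ρ τ : Fin n → Fin k) : ℝ :=
  if S.piecewise 0 ρ = ρ ∧ S.piecewise τ 0 = τ then Q (S.piecewise τ ρ) else 0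

/-- Pairs with `ρ` vanishing on `S` and `τ` vanishing off `S` are in bijection with multi-indices,
by gluing. -/
lemma sum_sum_piecewise {M : Type*} [AddCommMonoid M] (S : Finset (Fin n))
    (g : (Fin n → Fin k) → (Fin n → Fin k) → M) :
    ∑ ρ, ∑ τ, (if S.piecewise 0 ρ = ρ ∧ S.piecewise τ 0 = τ then g ρ τ else 0) =
      ∑ σ, g (S.piecewise 0 σ) (S.piecewise σ 0) := by
  rw [← Finset.sum_product', ← Finset.sum_filter]
  refine Finset.sum_nbij' (fun p => S.piecewise p.2 p.1)
    (fun σ => (S.piecewise 0 σ, S.piecewise σ 0)) ?_ ?_ ?_ ?_ ?_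
  · intro p _; simp
  · intro σ _; simp
  · rintro ⟨ρ, τ⟩ h
    simp only [Finset.univ_product_univ, Finset.mem_filter, Finset.mem_univ, true_and] at h
    ext1
    · simpa using h.1
    · simpa using h.2
  · intro σ _
    ext1 i
    by_cases hi : i ∈ S <;> simp [hi]
  · rintro ⟨ρ, τ⟩ h
    simp only [Finset.univ_product_univ, Finset.mem_filter, Finset.mem_univ, true_and] at h
    simp [h.1, h.2]

lemma piecewise_piecewise_self (S : Finset (Fin n)) (σ : Fin n → Fin k) :
    S.piecewise (S.piecewise σ 0) (S.piecewise 0 σ) = σ := by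
  ext1 i
  by_cases hi : i ∈ S <;> simp [hi]

lemma sum_sum_fiberCoeff_sq (S : Finset (Fin n)) (Q : (Fin n → Fin k) → ℝ) :
    ∑ ρ, ∑ τ, fiberCoeff S Q ρ τ ^ 2 = ∑ σ, Q σ ^ 2 := by
  have h : ∀ ρ τ, fiberCoeff S Q ρ τ ^ 2 =
      if S.piecewise 0 ρ = ρ ∧ S.piecewise τ 0 = τ then Q (S.piecewise τ ρ) ^ 2 else 0 := by
    intro ρ τ
    unfold fiberCoeff
    split_ifs <;> simp
  simp only [h]
  rw [sum_sum_piecewise S fun ρ τ => Q (S.piecewise τ ρ) ^ 2]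
  simp only [piecewise_piecewise_self]

lemma weight_piecewise_add (S : Finset (Fin n)) (σ : Fin n → Fin k) :
    weight (S.piecewise 0 σ) + weight (S.piecewise σ 0) = weight σ := by
  unfold weight
  rw [← Finset.card_union_of_disjoint]
  · congr 1
    ext i
    by_cases hi : i ∈ S <;> simp [hi]
  · rw [Finset.disjoint_filter]
    intro i _
    by_cases hi : i ∈ S <;> simp [hi]

lemma noiseOp_one (Q : (Fin n → Fin k) → ℝ) : noiseOp 1 Q = Q := by
  ext τ
  simp [noiseOp]

lemma noiseOp_noiseOp_inv {γ : ℝ} (hγ : γ ≠ 0) (Q : (Fin n → Fin k) → ℝ) :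
    noiseOp γ (noiseOp γ⁻¹ Q) = Q := by
  ext τ
  simp [noiseOp, hγ]

/-- Undoing the noise costs `γ⁻²` per unit of weight. This is where the bounded degree enters the
moment bounds. -/
lemma sum_sq_noiseOp_inv_le {γ : ℝ} (hγ : 0 < γ) (hγ1 : γ ≤ 1) {d : ℕ} {Q : (Fin n → Fin k) → ℝ}
    (hQ : ∀ σ, Q σ ≠ 0 → weight σ ≤ d) :
    ∑ σ, noiseOp γ⁻¹ Q σ ^ 2 ≤ ((γ ^ 2)⁻¹) ^ d * ∑ σ, Q σ ^ 2 := by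
  rw [Finset.mul_sum]
  refine Finset.sum_le_sum fun σ _ => ?_
  by_cases h : Q σ = 0
  · simp [noiseOp, h]
  · have h1 : (γ⁻¹ ^ weight σ) ^ 2 = ((γ ^ 2)⁻¹) ^ weight σ := by
      rw [← pow_mul, mul_comm, pow_mul, inv_pow]
    rw [noiseOp, mul_pow, h1]
    refine mul_le_mul_of_nonneg_right ?_ (sq_nonneg _)
    exact pow_le_pow_right₀ ((one_le_inv₀ (by positivity)).mpr (pow_le_one₀ hγ.le hγ1)) (hQ σ h)

end Fibers

/-! ### Second and fourth moments of hybrids. -/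

section Moments

/-- The sample point `ω` of an ensemble. -/
def sample {k n : ℕ} {Ω : Type*} (x : Fin n → Fin k → Ω → ℝ) (ω : Ω) : Fin n → Fin k → ℝ :=
  fun i j => x i j ω

variable {m n : ℕ} [NeZero m] {B : Fin (m ^ 2) → Matrix (Fin m) (Fin m) ℂ}

lemma ntr_tensorBasis_mul (hB : IsStandardOrthonormalBasis B) (σ τ : Fin n → Fin (m ^ 2)) :
    ntr (tensorBasis B σ * tensorBasis B τ) = if σ = τ then 1 else 0 := by
  have hm : (m : ℝ) ≠ 0 := Nat.cast_ne_zero.mpr (NeZero.ne m)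
  rw [ntr, tensorBasis_eq_tens, tensorBasis_eq_tens, tens_mul, trace_tens]
  by_cases h : σ = τ
  · simp only [h, hB.trace_mul, if_true, Finset.prod_const, Finset.card_univ, Fintype.card_fin,
      Fintype.card_pi]
    rw [← Nat.cast_pow, Complex.natCast_re]
    exact inv_mul_cancel₀ (by rw [Nat.cast_pow]; exact pow_ne_zero n hm)
  · obtain ⟨i, hi⟩ := Function.ne_iff.mp h
    rw [Finset.prod_eq_zero (Finset.mem_univ i) (by rw [hB.trace_mul, if_neg hi])]
    simp [h]

lemma ntr_tensorBasis (hB : IsStandardOrthonormalBasis B) (σ : Fin n → Fin (m ^ 2)) :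
    ntr (tensorBasis B σ) = if σ = 0 then 1 else 0 := by
  rw [← ntr_tensorBasis_mul hB σ 0]
  congr 1
  rw [tensorBasis_eq_tens B 0]
  simp [hB.zero_eq_one, tens_one]

lemma nsq_partialEval_empty (hB : IsStandardOrthonormalBasis B) (q : (Fin n → Fin (m ^ 2)) → ℝ)
    (v : Fin n → Fin (m ^ 2) → ℝ) : nsq (partialEval B ∅ q v) = ∑ ρ, q ρ ^ 2 := by
  rw [nsq_eq_of_isHermitian (partialEval_isHermitian hB _ _ _)]
  simp only [partialEval, Finset.prod_empty, mul_one, Finset.piecewise_empty, Finset.sum_mul_sum,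
    smul_mul_smul, ntr_sum, ntr_smul, ntr_tensorBasis_mul hB]
  simp [sq]

lemma ntr_partialEval_empty (hB : IsStandardOrthonormalBasis B) (q : (Fin n → Fin (m ^ 2)) → ℝ)
    (v : Fin n → Fin (m ^ 2) → ℝ) : ntr (partialEval B ∅ q v) = q 0 := by
  simp [partialEval, ntr_sum, ntr_smul, ntr_tensorBasis hB]

variable {Ω : Type*} {x : Fin n → Fin (m ^ 2) → Ω → ℝ}

/-- A partial evaluation is a Fourier expansion whose coefficients are polynomials. -/
lemma partialEval_noiseOp_eq (h0 : ∀ i ω, x i 0 ω = 1) (S : Finset (Fin n)) (γ : ℝ)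
    (Q : (Fin n → Fin (m ^ 2)) → ℝ) (ω : Ω) (v : Fin n → Fin (m ^ 2) → ℝ) :
    partialEval B S (noiseOp γ Q) (sample x ω) = partialEval B ∅ (noiseOp γ fun ρ =>
      multilinearEval x (noiseOp γ (fiberCoeff S Q ρ)) ω) v := by
  have h : ∀ ρ, (noiseOp γ (fun ρ => multilinearEval x (noiseOp γ (fiberCoeff S Q ρ)) ω) ρ *
      ∏ k ∈ (∅ : Finset (Fin n)), v k (ρ k)) • tensorBasis B ((∅ : Finset (Fin n)).piecewise 0 ρ) =
      ∑ τ, if S.piecewise 0 ρ = ρ ∧ S.piecewise τ 0 = τ then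
        (γ ^ (weight ρ + weight τ) * Q (S.piecewise τ ρ) * ∏ i, x i (τ i) ω) • tensorBasis B ρ
      else 0 := by
    intro ρ
    rw [Finset.prod_empty, mul_one, Finset.piecewise_empty, noiseOp, multilinearEval,
      Finset.mul_sum, Finset.sum_smul]
    refine Finset.sum_congr rfl fun τ _ => ?_
    rw [noiseOp, fiberCoeff]
    split_ifs
    · rw [pow_add]; congr 1; ring
    · simp
  rw [partialEval, partialEval]
  simp only [h]
  rw [sum_sum_piecewise S fun ρ τ =>
    (γ ^ (weight ρ + weight τ) * Q (S.piecewise τ ρ) * ∏ i, x i (τ i) ω) • tensorBasis B ρ]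
  refine Finset.sum_congr rfl fun σ _ => ?_
  -- The weight is additive under gluing, so the noise factors into noise on the matrix indices and
  -- noise on the scalar variables.
  rw [weight_piecewise_add, piecewise_piecewise_self, noiseOp]
  congr 2
  rw [← Finset.prod_subset (Finset.subset_univ S)]
  · refine Finset.prod_congr rfl fun i hi => ?_
    simp [hi, sample]
  · intro i _ hi
    simp [hi, h0]

lemma partialEval_eq (h0 : ∀ i ω, x i 0 ω = 1) (S : Finset (Fin n))
    (Q : (Fin n → Fin (m ^ 2)) → ℝ) (ω : Ω) (v : Fin n → Fin (m ^ 2) → ℝ) :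
    partialEval B S Q (sample x ω) =
      partialEval B ∅ (fun ρ => multilinearEval x (fiberCoeff S Q ρ) ω) v := by
  simpa only [noiseOp_one] using partialEval_noiseOp_eq (B := B) h0 S 1 Q ω v

variable [MeasurableSpace Ω] {μ : Measure Ω}

lemma IsEnsemble.measurable_sample (hx : IsEnsemble x μ) : Measurable (sample x) :=
  measurable_pi_lambda _ fun i => measurable_pi_lambda _ fun j => hx.measurable i j

lemma nsq_partialEval_eq (hB : IsStandardOrthonormalBasis B) (hx : IsEnsemble x μ)
    (S : Finset (Fin n)) (Q : (Fin n → Fin (m ^ 2)) → ℝ) (ω : Ω) :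
    nsq (partialEval B S Q (sample x ω)) = ∑ ρ, multilinearEval x (fiberCoeff S Q ρ) ω ^ 2 := by
  rw [partialEval_eq hx.zero_eq_one S Q ω 0, nsq_partialEval_empty hB]

lemma integrable_nsq_partialEval (hB : IsStandardOrthonormalBasis B) (hx : IsEnsemble x μ)
    (S : Finset (Fin n)) (Q : (Fin n → Fin (m ^ 2)) → ℝ) :
    Integrable (fun ω => nsq (partialEval B S Q (sample x ω))) μ := by
  simp only [nsq_partialEval_eq hB hx]
  exact integrable_finsetSum _ fun ρ _ => (hx.memLp_two_multilinearEval _).integrable_sq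

lemma integral_nsq_partialEval (hB : IsStandardOrthonormalBasis B) (hx : IsEnsemble x μ)
    (S : Finset (Fin n)) (Q : (Fin n → Fin (m ^ 2)) → ℝ) :
    ∫ ω, nsq (partialEval B S Q (sample x ω)) ∂μ = ∑ σ, Q σ ^ 2 := by
  simp only [nsq_partialEval_eq hB hx]
  rw [integral_finsetSum _ fun ρ _ => (hx.memLp_two_multilinearEval _).integrable_sq]
  simp only [hx.integral_multilinearEval_sq]
  exact sum_sum_fiberCoeff_sq S Q

lemma integrable_ntr_partialEval [IsProbabilityMeasure μ] (hB : IsStandardOrthonormalBasis B)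
    (hx : IsEnsemble x μ) (S : Finset (Fin n)) (Q : (Fin n → Fin (m ^ 2)) → ℝ) :
    Integrable (fun ω => ntr (partialEval B S Q (sample x ω))) μ := by
  simp only [partialEval_eq hx.zero_eq_one S Q _ 0, ntr_partialEval_empty hB]
  exact (hx.memLp_two_multilinearEval _).integrable one_le_two

lemma integral_ntr_partialEval [IsProbabilityMeasure μ] (hB : IsStandardOrthonormalBasis B)
    (hx : IsEnsemble x μ) (S : Finset (Fin n)) (Q : (Fin n → Fin (m ^ 2)) → ℝ) :
    ∫ ω, ntr (partialEval B S Q (sample x ω)) ∂μ = Q 0 := by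
  simp only [partialEval_eq hx.zero_eq_one S Q _ 0, ntr_partialEval_empty hB,
    hx.integral_multilinearEval]
  have h1 : S.piecewise (0 : Fin n → Fin (m ^ 2)) 0 = 0 := by
    ext1 i
    by_cases hi : i ∈ S <;> simp [hi]
  simp [fiberCoeff, h1]

lemma continuous_ntr {κ : Type*} [Fintype κ] : Continuous (ntr : Matrix κ κ ℂ → ℝ) := by
  unfold ntr
  fun_prop

lemma continuous_nsq {κ : Type*} [Fintype κ] : Continuous (nsq : Matrix κ κ ℂ → ℝ) := by
  unfold nsq
  exact continuous_ntr.comp (by fun_prop)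

/-- The fourth moment bound for partial evaluations with noise. -/
lemma integral_nsq_partialEval_noiseOp_le (hB : IsStandardOrthonormalBasis B)
    (hx : IsEnsemble x μ) {η γ : ℝ} (hη : 0 < η) (hh : IsHypercontractive x μ 2 4 η)
    (hγ0 : 0 ≤ γ) (hγη : γ ≤ η) (hγ : 9 * m * γ ^ 2 ≤ 1) (S : Finset (Fin n))
    (Q : (Fin n → Fin (m ^ 2)) → ℝ) :
    Integrable (fun ω => nsq (partialEval B S (noiseOp γ Q) (sample x ω) *
      partialEval B S (noiseOp γ Q) (sample x ω))) μ ∧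
    ∫ ω, nsq (partialEval B S (noiseOp γ Q) (sample x ω) *
      partialEval B S (noiseOp γ Q) (sample x ω)) ∂μ ≤ (∑ σ, Q σ ^ 2) ^ 2 := by
  set q : (Fin n → Fin (m ^ 2)) → Ω → ℝ := fun ρ =>
    multilinearEval x (noiseOp γ (fiberCoeff S Q ρ)) with hq
  have hq4 : ∀ ρ, MemLp (q ρ) 4 μ := fun ρ => hx.memLp_four_multilinearEval hη.ne' hh _
  have hq2 : ∀ ρ, MemLp (fun ω => q ρ ω ^ 2) 2 μ := fun ρ => memLp_two_sq (hq4 ρ)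
  set c : (Fin n → Fin (m ^ 2)) → ℝ := fun ρ => ∑ τ, fiberCoeff S Q ρ τ ^ 2 with hc
  have hc0 : ∀ ρ, 0 ≤ c ρ := fun ρ => Finset.sum_nonneg fun _ _ => sq_nonneg _
  have hqc : ∀ ρ, ∫ ω, (q ρ ω ^ 2) ^ 2 ∂μ ≤ c ρ ^ 2 := by
    intro ρ
    have := hx.integral_multilinearEval_noiseOp_pow_four_le hη hγ0 hγη hh (fiberCoeff S Q ρ)
    simpa only [← pow_mul] using! this
  -- For a fixed sample, noncommutative hypercontractivity handles the kept registers; the bound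
  -- left over is a polynomial in scalar variables only.
  have hpt : ∀ ω, nsq (partialEval B S (noiseOp γ Q) (sample x ω) *
      partialEval B S (noiseOp γ Q) (sample x ω)) ≤ ∑ ρ, ∑ τ, q ρ ω ^ 2 * q τ ω ^ 2 := by
    intro ω
    rw [partialEval_noiseOp_eq hx.zero_eq_one S γ Q ω 0]
    refine (nsq_partialEval_noiseOp_le hB hγ 0 _).trans (le_of_eq ?_)
    rw [sq, Finset.sum_mul_sum]
  have hint : ∀ ρ τ, Integrable (fun ω => q ρ ω ^ 2 * q τ ω ^ 2) μ := fun ρ τ =>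
    (hq2 ρ).integrable_mul (hq2 τ)
  have hint2 : Integrable (fun ω => ∑ ρ, ∑ τ, q ρ ω ^ 2 * q τ ω ^ 2) μ :=
    integrable_finsetSum _ fun ρ _ => integrable_finsetSum _ fun τ _ => hint ρ τ
  have hmeas : Measurable (fun ω => nsq (partialEval B S (noiseOp γ Q) (sample x ω) *
      partialEval B S (noiseOp γ Q) (sample x ω))) := by
    have h1 : Continuous fun v => nsq (partialEval B S (noiseOp γ Q) v *
        partialEval B S (noiseOp γ Q) v) :=
      continuous_nsq.comp ((continuous_partialEval S _).mul (continuous_partialEval S _))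
    exact h1.measurable.comp hx.measurable_sample
  have hint3 : Integrable (fun ω => nsq (partialEval B S (noiseOp γ Q) (sample x ω) *
      partialEval B S (noiseOp γ Q) (sample x ω))) μ :=
    hint2.mono' hmeas.aestronglyMeasurable (Filter.Eventually.of_forall fun ω => by
      rw [Real.norm_of_nonneg (nsq_nonneg _)]
      exact hpt ω)
  refine ⟨hint3, (integral_mono hint3 hint2 hpt).trans ?_⟩
  rw [integral_finsetSum _ fun ρ _ => integrable_finsetSum _ fun τ _ => hint ρ τ,
    ← sum_sum_fiberCoeff_sq S Q]
  change _ ≤ (∑ ρ, c ρ) ^ 2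
  rw [sq (∑ ρ, c ρ), Finset.sum_mul_sum]
  refine Finset.sum_le_sum fun ρ _ => ?_
  rw [integral_finsetSum _ fun τ _ => hint ρ τ]
  refine Finset.sum_le_sum fun τ _ => ?_
  -- Cauchy–Schwarz over the sample space, followed by scalar hypercontractivity on each fiber,
  -- bounds the mixed moment by `c ρ * c τ`.
  refine (abs_le_of_sq_le_sq' ((sq_integral_mul_le (hq2 ρ) (hq2 τ)).trans ?_)
    (mul_nonneg (hc0 ρ) (hc0 τ))).2
  rw [mul_pow]
  exact mul_le_mul (hqc ρ) (hqc τ) (integral_nonneg fun ω => sq_nonneg _) (sq_nonneg _)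

/-- The fourth moment bound for partial evaluations of low degree. -/
lemma integral_nsq_partialEval_mul_self_le (hB : IsStandardOrthonormalBasis B)
    (hx : IsEnsemble x μ) {η : ℝ} (hη : 0 < η) (hη1 : η < 1) (hh : IsHypercontractive x μ 2 4 η)
    (S : Finset (Fin n)) {d : ℕ} {Q : (Fin n → Fin (m ^ 2)) → ℝ}
    (hQ : ∀ σ, Q σ ≠ 0 → weight σ ≤ d) :
    Integrable (fun ω => nsq (partialEval B S Q (sample x ω) *
      partialEval B S Q (sample x ω))) μ ∧
    ∫ ω, nsq (partialEval B S Q (sample x ω) * partialEval B S Q (sample x ω)) ∂μ ≤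
      (max (9 * (m : ℝ)) (1 / η ^ 4) ^ d * ∑ σ, Q σ ^ 2) ^ 2 := by
  set K := max (9 * (m : ℝ)) (1 / η ^ 4) with hK
  have hm : 1 ≤ (m : ℝ) := by exact_mod_cast NeZero.one_le
  have hK1 : 9 * (m : ℝ) ≤ K := le_max_left _ _
  have hK2 : 1 / η ^ 4 ≤ K := le_max_right _ _
  have hK0 : 0 < K := by linarith
  -- This rate meets both constraints: `9mγ² ≤ 1`, and `γ² ≤ η⁴ ≤ η²`. Undoing it costs exactly
  -- `(γ⁻²)^d = K^d`.
  set γ := √K⁻¹ with hγdef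
  have hγsq : γ ^ 2 = K⁻¹ := Real.sq_sqrt (by positivity)
  have hγ0 : 0 < γ := Real.sqrt_pos.mpr (by positivity)
  have hγη : γ ≤ η := by
    rw [hγdef, Real.sqrt_le_left hη.le]
    rw [inv_le_comm₀ hK0 (by positivity)]
    refine le_trans ?_ hK2
    rw [one_div]
    exact inv_anti₀ (by positivity) (pow_le_pow_of_le_one hη.le hη1.le (by norm_num))
  have hγ1 : γ ≤ 1 := hγη.trans hη1.le
  have hγ9 : 9 * m * γ ^ 2 ≤ 1 := by
    rw [hγsq, ← div_eq_mul_inv]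
    exact (div_le_one hK0).mpr hK1
  have h := integral_nsq_partialEval_noiseOp_le hB hx hη hh hγ0.le hγη hγ9 S (noiseOp γ⁻¹ Q)
  rw [noiseOp_noiseOp_inv hγ0.ne'] at h
  refine ⟨h.1, h.2.trans (pow_le_pow_left₀ (Finset.sum_nonneg fun _ _ => sq_nonneg _) ?_ 2)⟩
  have := sum_sq_noiseOp_inv_le hγ0 hγ1 hQ
  rwa [hγsq, inv_inv] at this

end Moments

/-! ### Measurability of resolvent traces and bounds in trace form. -/

section ResolventRegularity

variable {κ : Type*} [Fintype κ] [DecidableEq κ]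

lemma continuous_rsv {α : Type*} [TopologicalSpace α] {f : α → Matrix κ κ ℂ} (hf : Continuous f)
    (hh : ∀ a, (f a).IsHermitian) {y : ℝ} (hy : y ≠ 0) : Continuous fun a => rsv (f a) y := by
  unfold rsv
  simp only [Matrix.inv_def, Ring.inverse_eq_inv']
  have h1 : Continuous fun a => f a - ((y : ℂ) * Complex.I) • (1 : Matrix κ κ ℂ) :=
    hf.sub continuous_const
  refine Continuous.smul (h1.matrix_det.inv₀ fun a => ?_) h1.matrix_adjugate
  exact ((Matrix.isUnit_iff_isUnit_det _).mp (isUnit_sub_smul_one (hh a) hy)).ne_zero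

/-- The inverse is `det⁻¹` times the adjugate, with `0⁻¹ = 0`; hence measurability holds also where
the matrix is singular, and `y = 0` need not be excluded. -/
lemma measurable_ntr_rsv {α : Type*} [TopologicalSpace α] [MeasurableSpace α]
    [OpensMeasurableSpace α] {f : α → Matrix κ κ ℂ} (hf : Continuous f) {g : α → ℝ}
    (hg : Continuous g) : Measurable fun a => ntr (rsv (f a) (g a)) := by
  unfold rsv ntr
  simp only [Matrix.inv_def, Ring.inverse_eq_inv', Matrix.trace_smul, smul_eq_mul]
  have h1 : Continuous fun a => f a - ((g a : ℂ) * Complex.I) • (1 : Matrix κ κ ℂ) := by fun_prop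
  exact (Complex.measurable_re.comp
    (h1.matrix_det.measurable.inv.mul h1.matrix_adjugate.matrix_trace.measurable)).const_mul _

/-- The free parameter `s` turns the geometric mean from Cauchy–Schwarz into a sum, whose
expectation can be taken term by term. -/
lemma abs_rsv_remainder_le {A R : Matrix κ κ ℂ} (hA : A.IsHermitian) (hR : R.IsHermitian)
    {y s : ℝ} (hy : y ≠ 0) (hs : 0 < s) :
    |ntr ((rsv A y * R * rsv A y * R) * (rsv A y * R * rsv (A + R) y))| ≤
      (y ^ 4)⁻¹ * ((s * nsq R + s⁻¹ * nsq (R * R)) / 2) := by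
  have h := rsv_remainder_sq_le hA hR hy
  have h1 := nsq_nonneg R
  have h2 := nsq_nonneg (R * R)
  have hy4 : 0 < y ^ 4 := by positivity
  refine abs_le_of_sq_le_sq (h.trans ?_) (by positivity)
  rw [mul_pow, inv_pow, ← pow_mul]
  refine mul_le_mul_of_nonneg_left ?_ (by positivity)
  have h3 : nsq R * nsq (R * R) = (s * nsq R) * (s⁻¹ * nsq (R * R)) := by field_simp
  rw [h3]
  nlinarith [sq_nonneg (s * nsq R - s⁻¹ * nsq (R * R))]

lemma ntr_rsv_add {A R : Matrix κ κ ℂ} (hA : A.IsHermitian) (hR : R.IsHermitian) {y : ℝ}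
    (hy : y ≠ 0) : ntr (rsv (A + R) y) = ntr (rsv A y) - ntr (rsv A y * rsv A y * R) +
      ntr (rsv A y * rsv A y * R * rsv A y * R) -
      ntr ((rsv A y * R * rsv A y * R) * (rsv A y * R * rsv (A + R) y)) := by
  have h := congrArg ntr (rsv_add_expansion hA hR hy)
  have h1 : ntr (rsv A y * R * rsv A y) = ntr (rsv A y * rsv A y * R) := by
    rw [ntr_mul_comm, Matrix.mul_assoc]
  have h2 : ntr (rsv A y * R * rsv A y * R * rsv A y) =
      ntr (rsv A y * rsv A y * R * rsv A y * R) := by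
    rw [ntr_mul_comm]
    simp only [Matrix.mul_assoc]
  rwa [ntr_sub, ntr_add, ntr_sub, h1, h2] at h

end ResolventRegularity

/-! ### Lindeberg replacement for resolvents. -/

section Lindeberg

variable {m n : ℕ} [NeZero m] {B : Fin (m ^ 2) → Matrix (Fin m) (Fin m) ℂ}

/-- The base point `slice i 0 Q` is the same here and in `partialEval_insert_eq_add`, so both
hybrids of a replacement step are expanded around one matrix. -/
lemma partialEval_eq_add (hB : IsStandardOrthonormalBasis B) {i : Fin n} {S : Finset (Fin n)}
    (hi : i ∉ S) (Q : (Fin n → Fin (m ^ 2)) → ℝ) (v : Fin n → Fin (m ^ 2) → ℝ) :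
    partialEval B S (dependPart i Q) v =
        ∑ j ∈ Finset.univ.erase 0, emb i (B j) * partialEval B S (slice i j Q) v ∧
      partialEval B S Q v = partialEval B S (slice i 0 Q) v +
        partialEval B S (dependPart i Q) v := by
  have h1 : partialEval B S (dependPart i Q) v =
      ∑ j ∈ Finset.univ.erase 0, emb i (B j) * partialEval B S (slice i j Q) v := by
    rw [partialEval_eq_sum_emb hB hi, ← Finset.add_sum_erase _ _ (Finset.mem_univ 0),
      slice_zero_dependPart, partialEval_zero, mul_zero, zero_add]
    refine Finset.sum_congr rfl fun j hj => ?_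
    rw [slice_dependPart i (Finset.ne_of_mem_erase hj)]
  refine ⟨h1, ?_⟩
  rw [h1, partialEval_eq_sum_emb hB hi, ← Finset.add_sum_erase _ _ (Finset.mem_univ 0),
    hB.zero_eq_one, emb_one, one_mul]

lemma partialEval_insert_eq_add {i : Fin n} {S : Finset (Fin n)}
    (hi : i ∉ S) (Q : (Fin n → Fin (m ^ 2)) → ℝ) {v : Fin n → Fin (m ^ 2) → ℝ}
    (hv : v i 0 = 1) :
    partialEval B (insert i S) (dependPart i Q) v =
        ∑ j ∈ Finset.univ.erase 0, v i j • partialEval B S (slice i j Q) v ∧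
      partialEval B (insert i S) Q v = partialEval B S (slice i 0 Q) v +
        partialEval B (insert i S) (dependPart i Q) v := by
  have h1 : partialEval B (insert i S) (dependPart i Q) v =
      ∑ j ∈ Finset.univ.erase 0, v i j • partialEval B S (slice i j Q) v := by
    rw [partialEval_insert hi, ← Finset.add_sum_erase _ _ (Finset.mem_univ 0),
      slice_zero_dependPart, partialEval_zero, smul_zero, zero_add]
    refine Finset.sum_congr rfl fun j hj => ?_
    rw [slice_dependPart i (Finset.ne_of_mem_erase hj)]
  refine ⟨h1, ?_⟩
  rw [h1, partialEval_insert hi, ← Finset.add_sum_erase _ _ (Finset.mem_univ 0), hv, one_smul]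

variable {Ω : Type*} [MeasurableSpace Ω] {μ : Measure Ω}
  {x : Fin n → Fin (m ^ 2) → Ω → ℝ}

lemma integrable_ntr_rsv_partialEval [IsProbabilityMeasure μ] (hB : IsStandardOrthonormalBasis B) (hx : IsEnsemble x μ)
    (S : Finset (Fin n)) (Q : (Fin n → Fin (m ^ 2)) → ℝ) {y : ℝ} (hy : 0 < y) :
    Integrable (fun ω => ntr (rsv (partialEval B S Q (sample x ω)) y)) μ := by
  refine (integrable_const y⁻¹).mono' ?_ (Filter.Eventually.of_forall fun ω =>
    abs_ntr_rsv_le (partialEval_isHermitian hB _ _ _) hy)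
  exact ((measurable_ntr_rsv (continuous_partialEval S Q) continuous_const).comp
    hx.measurable_sample).aestronglyMeasurable

/-- The bound for the third order remainder when one register is expanded. -/
lemma integral_abs_remainder_le (hB : IsStandardOrthonormalBasis B)
    (hx : IsEnsemble x μ) {η : ℝ} (hη : 0 < η) (hη1 : η < 1) (hh : IsHypercontractive x μ 2 4 η)
    (S : Finset (Fin n)) {d : ℕ} {Q : (Fin n → Fin (m ^ 2)) → ℝ}
    (hQ : ∀ σ, Q σ ≠ 0 → weight σ ≤ d) {τ : ℝ} (hτ : 0 < τ) (hle : ∑ σ, Q σ ^ 2 ≤ τ)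
    {y : ℝ} (hy : 0 < y) {A : Ω → Matrix (Fin n → Fin m) (Fin n → Fin m) ℂ}
    (hA : ∀ ω, (A ω).IsHermitian) :
    |∫ ω, ntr ((rsv (A ω) y * partialEval B S Q (sample x ω) * rsv (A ω) y *
      partialEval B S Q (sample x ω)) * (rsv (A ω) y * partialEval B S Q (sample x ω) *
        rsv (A ω + partialEval B S Q (sample x ω)) y)) ∂μ| ≤
      (y ^ 4)⁻¹ * (max (9 * (m : ℝ)) (1 / η ^ 4) ^ d * √τ * ∑ σ, Q σ ^ 2) := by
  set K := max (9 * (m : ℝ)) (1 / η ^ 4) with hK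
  set I := ∑ σ, Q σ ^ 2 with hI
  have hI0 : 0 ≤ I := Finset.sum_nonneg fun _ _ => sq_nonneg _
  have hK0 : 0 < K := lt_of_lt_of_le (by positivity) (le_max_right _ _)
  have hsτ : 0 < √τ := Real.sqrt_pos.mpr hτ
  -- This balances the two terms: the mean of `nsq R` is `I`, and that of `nsq (R * R)` is at most
  -- `K^(2d) I² ≤ K^(2d) τ I = s² I`.
  set s := K ^ d * √τ with hs
  have hs0 : 0 < s := by positivity
  obtain ⟨h4, h4'⟩ := integral_nsq_partialEval_mul_self_le hB hx hη hη1 hh S hQ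
  have h2 := integrable_nsq_partialEval hB hx S Q
  have h2' := integral_nsq_partialEval hB hx S Q
  rw [← Real.norm_eq_abs]
  have hint : Integrable (fun ω => (y ^ 4)⁻¹ * ((s * nsq (partialEval B S Q (sample x ω)) +
      s⁻¹ * nsq (partialEval B S Q (sample x ω) * partialEval B S Q (sample x ω))) / 2)) μ :=
    (((h2.const_mul _).add (h4.const_mul _)).div_const _).const_mul _
  refine (norm_integral_le_of_norm_le hint (Filter.Eventually.of_forall fun ω =>
    abs_rsv_remainder_le (hA ω) (partialEval_isHermitian hB _ _ _) hy.ne' hs0)).trans ?_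
  rw [integral_const_mul, integral_div, integral_add (h2.const_mul _) (h4.const_mul _),
    integral_const_mul, integral_const_mul, h2']
  refine mul_le_mul_of_nonneg_left ?_ (by positivity)
  have h5 : s⁻¹ * ∫ ω, nsq (partialEval B S Q (sample x ω) * partialEval B S Q (sample x ω)) ∂μ ≤
      s * I := by
    rw [inv_mul_le_iff₀ hs0]
    refine h4'.trans ?_
    have h6 : (K ^ d * I) ^ 2 = (K ^ d) ^ 2 * I * I := by ring
    have h7 : s * (s * I) = (K ^ d) ^ 2 * I * τ := by
      rw [hs]
      linear_combination (K ^ d) ^ 2 * I * Real.sq_sqrt hτ.le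
    rw [h6, h7]
    exact mul_le_mul_of_nonneg_left hle (by positivity)
  have : s * I = K ^ d * √τ * I := by rw [hs]
  linarith

set_option maxHeartbeats 1000000 in
/-- One replacement step for the resolvent. -/
lemma abs_integral_rsv_sub_le [IsProbabilityMeasure μ] (hB : IsStandardOrthonormalBasis B)
    (hx : IsEnsemble x μ) {η : ℝ} (hη : 0 < η) (hη1 : η < 1) (hh : IsHypercontractive x μ 2 4 η)
    {S : Finset (Fin n)} {i : Fin n} (hi : i ∉ S) {d : ℕ} {Q : (Fin n → Fin (m ^ 2)) → ℝ}
    (hQ : ∀ σ, Q σ ≠ 0 → weight σ ≤ d) {τ : ℝ} (hτ : 0 < τ)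
    (hle : ∑ σ, dependPart i Q σ ^ 2 ≤ τ) {y : ℝ} (hy : 0 < y) :
    |∫ ω, ntr (rsv (partialEval B S Q (sample x ω)) y) ∂μ -
      ∫ ω, ntr (rsv (partialEval B (insert i S) Q (sample x ω)) y) ∂μ| ≤
      2 * ((y ^ 4)⁻¹ * (max (9 * (m : ℝ)) (1 / η ^ 4) ^ d * √τ *
        ∑ σ, dependPart i Q σ ^ 2)) := by
  set A := fun v => partialEval B S (slice i 0 Q) v with hAdef
  set C := fun j v => partialEval B S (slice i j Q) v with hCdef
  set G := fun v => rsv (A v) y with hGdef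
  set R := fun v => partialEval B S (dependPart i Q) v with hRdef
  set R' := fun v => partialEval B (insert i S) (dependPart i Q) v with hR'def
  have hAh : ∀ v, (A v).IsHermitian := fun v => partialEval_isHermitian hB _ _ _
  have hRh : ∀ v, (R v).IsHermitian := fun v => partialEval_isHermitian hB _ _ _
  have hR'h : ∀ v, (R' v).IsHermitian := fun v => partialEval_isHermitian hB _ _ _
  have hCc : ∀ j, Continuous (C j) := fun j => continuous_partialEval _ _
  have hGc : Continuous G := continuous_rsv (continuous_partialEval _ _) hAh hy.ne'
  have hCcomm : ∀ v k j, Commute (emb i (B k)) (C j v) := fun v k j =>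
    commute_emb_partialEval_slice hB i S j k Q v
  have hGcomm : ∀ v k, Commute (emb i (B k)) (G v) := fun v k =>
    (commute_rsv (hCcomm v k 0).symm (hAh v) hy.ne').symm
  have hQd : ∀ σ, dependPart i Q σ ≠ 0 → weight σ ≤ d := by
    intro σ hσ
    by_cases h : σ i = 0
    · simp [dependPart, h] at hσ
    · exact hQ σ (by simpa [dependPart, h] using hσ)
  set rem := fun v => ntr ((G v * R v * G v * R v) * (G v * R v * rsv (A v + R v) y)) with hrem
  set rem' := fun v => ntr ((G v * R' v * G v * R' v) * (G v * R' v * rsv (A v + R' v) y))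
    with hrem'
  set F1 := fun j v => ntr (G v * G v * C j v) with hF1
  set F2 := fun j l v => ntr (G v * G v * C j v * G v * C l v) with hF2
  set s : Finset (Fin (m ^ 2)) := Finset.univ.erase 0 with hs
  have hexp : ∀ (v) (R : Matrix (Fin n → Fin m) (Fin n → Fin m) ℂ), R.IsHermitian →
      ntr (rsv (A v + R) y) = ntr (G v) - ntr (G v * G v * R) + ntr (G v * G v * R * G v * R) -
        ntr ((G v * R * G v * R) * (G v * R * rsv (A v + R) y)) :=
    fun v R hR => ntr_rsv_add (hAh v) hR hy.ne'
  -- Register `i` is kept: the linear term vanishes by tracelessness, and orthogonality reduces the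
  -- quadratic one to its diagonal, pointwise in `v`.
  have e1 : ∀ v, ntr (rsv (partialEval B S Q v) y) =
      ntr (G v) + ∑ j ∈ s, F2 j j v - rem v := by
    intro v
    obtain ⟨ha, hb⟩ := partialEval_eq_add hB hi Q v
    have hz : ntr (G v * G v * R v) = 0 := by
      rw [hRdef]
      simp only [ha]
      exact ntr_mul_sum_emb_eq_zero hB i (fun k => (hGcomm v k).mul_right (hGcomm v k))
        (hCcomm v) (by simp)
    have hq : ntr (G v * G v * R v * G v * R v) = ∑ j ∈ s, F2 j j v := by
      rw [hRdef]
      simp only [ha]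
      exact ntr_mul_sum_emb_mul_sum_emb hB i (fun k => (hGcomm v k).mul_right (hGcomm v k))
        (hGcomm v) (hCcomm v) _
    rw [hb, hexp v _ (hRh v), hz, hq, sub_zero]
  -- Register `i` is substituted: the same coefficients `F1`, `F2` appear against scalars `x i j`,
  -- and the cancellations happen only in expectation.
  have e2 : ∀ ω, ntr (rsv (partialEval B (insert i S) Q (sample x ω)) y) =
      ntr (G (sample x ω)) - ∑ j ∈ s, F1 j (sample x ω) * x i j ω +
        ∑ j ∈ s, ∑ l ∈ s, F2 j l (sample x ω) * (x i j ω * x i l ω) - rem' (sample x ω) := by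
    intro ω
    obtain ⟨ha, hb⟩ := partialEval_insert_eq_add (B := B) hi Q
      (v := sample x ω) (hx.zero_eq_one i ω)
    set v := sample x ω with hv
    have hz : ntr (G v * G v * R' v) = ∑ j ∈ s, F1 j v * x i j ω := by
      rw [hR'def]
      simp only [ha, Finset.mul_sum, mul_smul_comm, ntr_sum, ntr_smul]
      exact Finset.sum_congr rfl fun j _ => mul_comm _ _
    have hq : ntr (G v * G v * R' v * G v * R' v) =
        ∑ j ∈ s, ∑ l ∈ s, F2 j l v * (x i j ω * x i l ω) := by
      rw [hR'def]
      simp only [ha, Finset.mul_sum, Finset.sum_mul, mul_smul_comm, smul_mul_assoc, ntr_sum,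
        ntr_smul]
      rw [Finset.sum_comm]
      refine Finset.sum_congr rfl fun j _ => Finset.sum_congr rfl fun l _ => ?_
      simp only [hF2, hv, sample]
      ring
    rw [hb, hexp v _ (hR'h v), hz, hq]
  have hnG : ∀ v, nsq (G v) ≤ (y ^ 2)⁻¹ := by
    intro v
    have := nsq_mul_rsv_le (hAh v) hy.ne' 1
    rw [one_mul] at this
    simpa [nsq, ntr_one] using this
  have hnC : ∀ j, Integrable (fun ω => nsq (C j (sample x ω))) μ := fun j =>
    integrable_nsq_partialEval hB hx S _
  have hF1c : ∀ j, Continuous (F1 j) := fun j =>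
    continuous_ntr.comp ((hGc.mul hGc).mul (hCc j))
  have hF2c : ∀ j l, Continuous (F2 j l) := fun j l =>
    continuous_ntr.comp ((((hGc.mul hGc).mul (hCc j)).mul hGc).mul (hCc l))
  have hCS : ∀ j (v w : Fin n → Fin (m ^ 2) → ℝ), (∀ l ∈ S, v l = w l) → C j v = C j w :=
    fun j v w h => partialEval_congr _ h
  have hGS : ∀ (v w : Fin n → Fin (m ^ 2) → ℝ), (∀ l ∈ S, v l = w l) → G v = G w :=
    fun v w h => congrArg (fun Z => rsv Z y) (hCS 0 v w h)
  have hF1i : ∀ j, Integrable (fun ω => F1 j (sample x ω)) μ := by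
    intro j
    refine (((integrable_const ((y ^ 2)⁻¹ * (y ^ 2)⁻¹)).add (hnC j)).div_const 2).mono'
      ((hF1c j).measurable.comp hx.measurable_sample).aestronglyMeasurable
      (Filter.Eventually.of_forall fun ω => ?_)
    have h1 := two_mul_abs_ntr_mul_le (G (sample x ω) * G (sample x ω)) (C j (sample x ω))
    have h2 := (nsq_rsv_mul_le (hAh (sample x ω)) hy.ne' (G (sample x ω))).trans
      (mul_le_mul_of_nonneg_left (hnG (sample x ω)) (by positivity))
    change nsq (G (sample x ω) * G (sample x ω)) ≤ _ at h2
    rw [Real.norm_eq_abs]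
    simp only [hF1, Pi.add_apply]
    linarith
  have hF2i : ∀ j l, Integrable (fun ω => F2 j l (sample x ω)) μ := by
    intro j l
    refine ((((hnC j).const_mul ((y ^ 2)⁻¹ * (y ^ 2)⁻¹)).add
      ((hnC l).const_mul (y ^ 2)⁻¹)).div_const 2).mono'
      ((hF2c j l).measurable.comp hx.measurable_sample).aestronglyMeasurable
      (Filter.Eventually.of_forall fun ω => ?_)
    set v := sample x ω
    have h1 := two_mul_abs_ntr_mul_le (G v * (G v * C j v)) (G v * C l v)
    have h2 := (nsq_rsv_mul_le (hAh v) hy.ne' (G v * C j v)).trans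
      (mul_le_mul_of_nonneg_left (nsq_rsv_mul_le (hAh v) hy.ne' (C j v)) (by positivity))
    have h3 := nsq_rsv_mul_le (hAh v) hy.ne' (C l v)
    change nsq (G v * (G v * C j v)) ≤ _ at h2
    change nsq (G v * C l v) ≤ _ at h3
    rw [show G v * (G v * C j v) * (G v * C l v) = G v * G v * C j v * G v * C l v by
      noncomm_ring] at h1
    rw [Real.norm_eq_abs]
    simp only [hF2, Pi.add_apply]
    linarith
  have hxi : ∀ j, Integrable (x i j) μ := fun j => (hx.memLp_two i j).integrable one_le_two
  have hxij : ∀ j l, Integrable (fun ω => x i j ω * x i l ω) μ := fun j l =>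
    (hx.memLp_two i j).integrable_mul (hx.memLp_two i l)
  have ind1 : ∀ j, IndepFun (fun ω => F1 j (sample x ω)) (x i j) μ := fun j =>
    IsEnsemble.indepFun_of_notMem hx hi (hF1c j).measurable
      (fun v w h => by simp only [hF1, hGS v w h, hCS j v w h]) (measurable_pi_apply j)
  have ind2 : ∀ j l, IndepFun (fun ω => F2 j l (sample x ω)) (fun ω => x i j ω * x i l ω) μ :=
    fun j l => IsEnsemble.indepFun_of_notMem hx hi (hF2c j l).measurable
      (fun v w h => by simp only [hF2, hGS v w h, hCS j v w h, hCS l v w h])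
      (f := fun u => u j * u l) (by fun_prop)
  have i1 : ∀ j, Integrable (fun ω => F1 j (sample x ω) * x i j ω) μ := fun j =>
    (ind1 j).integrable_mul (hF1i j) (hxi j)
  have i2 : ∀ j l, Integrable (fun ω => F2 j l (sample x ω) * (x i j ω * x i l ω)) μ := fun j l =>
    (ind2 j l).integrable_mul (hF2i j l) (hxij j l)
  have iG : Integrable (fun ω => ntr (G (sample x ω))) μ :=
    integrable_ntr_rsv_partialEval hB hx S _ hy
  have iM := integrable_ntr_rsv_partialEval hB hx S Q hy
  have iM' := integrable_ntr_rsv_partialEval hB hx (insert i S) Q hy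
  have iF2 : Integrable (fun ω => ∑ j ∈ s, F2 j j (sample x ω)) μ :=
    integrable_finsetSum _ fun j _ => hF2i j j
  have iS1 : Integrable (fun ω => ∑ j ∈ s, F1 j (sample x ω) * x i j ω) μ :=
    integrable_finsetSum _ fun j _ => i1 j
  have iS2 : Integrable (fun ω => ∑ j ∈ s, ∑ l ∈ s,
      F2 j l (sample x ω) * (x i j ω * x i l ω)) μ :=
    integrable_finsetSum _ fun j _ => integrable_finsetSum _ fun l _ => i2 j l
  -- The remainder is integrable as a combination of the other, integrable terms of the expansion.
  have irem : Integrable (fun ω => rem (sample x ω)) μ := by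
    have : (fun ω => rem (sample x ω)) = fun ω => (ntr (G (sample x ω)) +
        ∑ j ∈ s, F2 j j (sample x ω)) - ntr (rsv (partialEval B S Q (sample x ω)) y) := by
      ext ω
      rw [e1]; ring
    rw [this]
    exact (iG.add iF2).sub iM
  have irem' : Integrable (fun ω => rem' (sample x ω)) μ := by
    have : (fun ω => rem' (sample x ω)) = fun ω => (ntr (G (sample x ω)) -
        ∑ j ∈ s, F1 j (sample x ω) * x i j ω +
        ∑ j ∈ s, ∑ l ∈ s, F2 j l (sample x ω) * (x i j ω * x i l ω)) -
          ntr (rsv (partialEval B (insert i S) Q (sample x ω)) y) := by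
      ext ω
      rw [e2]; ring
    rw [this]
    exact ((iG.sub iS1).add iS2).sub iM'
  have hx1 : ∀ j ∈ s, ∫ ω, x i j ω ∂μ = 0 := by
    intro j hj
    have := hx.orthonormal i j 0
    simpa [hx.zero_eq_one, Finset.ne_of_mem_erase hj] using this
  have E1 : ∫ ω, ∑ j ∈ s, F1 j (sample x ω) * x i j ω ∂μ = 0 := by
    rw [integral_finsetSum _ fun j _ => i1 j]
    refine Finset.sum_eq_zero fun j hj => ?_
    rw [(ind1 j).integral_fun_mul_eq_mul_integral (hF1i j).1 (hxi j).1, hx1 j hj, mul_zero]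
  -- `F2` depends only on the variables indexed by `S`, and `i ∉ S`; independence and orthonormality
  -- thus leave the diagonal found in `e1`.
  have E2 : ∫ ω, ∑ j ∈ s, ∑ l ∈ s, F2 j l (sample x ω) * (x i j ω * x i l ω) ∂μ =
      ∫ ω, ∑ j ∈ s, F2 j j (sample x ω) ∂μ := by
    rw [integral_finsetSum _ fun j _ => integrable_finsetSum _ fun l _ => i2 j l,
      integral_finsetSum _ fun j _ => hF2i j j]
    refine Finset.sum_congr rfl fun j hj => ?_
    rw [integral_finsetSum _ fun l _ => i2 j l]
    have : ∀ l, ∫ ω, F2 j l (sample x ω) * (x i j ω * x i l ω) ∂μ =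
        if j = l then ∫ ω, F2 j l (sample x ω) ∂μ else 0 := by
      intro l
      rw [(ind2 j l).integral_fun_mul_eq_mul_integral (hF2i j l).1 (hxij j l).1,
        hx.orthonormal]
      split_ifs <;> simp
    simp only [this, Finset.sum_ite_eq, hj, if_true]
  have T1 : ∫ ω, ntr (rsv (partialEval B S Q (sample x ω)) y) ∂μ = ∫ ω, ntr (G (sample x ω)) ∂μ +
      ∫ ω, ∑ j ∈ s, F2 j j (sample x ω) ∂μ - ∫ ω, rem (sample x ω) ∂μ := by
    simp only [e1]
    have iGF : Integrable (fun ω => ntr (G (sample x ω)) + ∑ j ∈ s, F2 j j (sample x ω)) μ :=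
      iG.add iF2
    rw [integral_sub iGF irem, integral_add iG iF2]
  have T2 : ∫ ω, ntr (rsv (partialEval B (insert i S) Q (sample x ω)) y) ∂μ =
      ∫ ω, ntr (G (sample x ω)) ∂μ +
      ∫ ω, ∑ j ∈ s, F2 j j (sample x ω) ∂μ - ∫ ω, rem' (sample x ω) ∂μ := by
    simp only [e2]
    have iGS : Integrable (fun ω => ntr (G (sample x ω)) -
      ∑ j ∈ s, F1 j (sample x ω) * x i j ω) μ := iG.sub iS1
    have iGSS : Integrable (fun ω => ntr (G (sample x ω)) -
        ∑ j ∈ s, F1 j (sample x ω) * x i j ω +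
        ∑ j ∈ s, ∑ l ∈ s, F2 j l (sample x ω) * (x i j ω * x i l ω)) μ := iGS.add iS2
    rw [integral_sub iGSS irem', integral_add iGS iS2, integral_sub iG iS1, E1, E2,
      sub_zero]
  have b1 := integral_abs_remainder_le hB hx hη hη1 hh S hQd hτ hle hy
    (A := fun ω => A (sample x ω)) fun ω => hAh _
  have b2 := integral_abs_remainder_le hB hx hη hη1 hh (insert i S) hQd hτ hle hy
    (A := fun ω => A (sample x ω)) fun ω => hAh _
  change |∫ ω, rem (sample x ω) ∂μ| ≤ _ at b1
  change |∫ ω, rem' (sample x ω) ∂μ| ≤ _ at b2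
  rw [T1, T2]
  have e3 : ∀ a b c d : ℝ, (a + b - c) - (a + b - d) = d - c := fun a b c d => by ring
  rw [e3]
  refine (abs_sub _ _).trans ?_
  linarith

/-- The replacement principle for the resolvent. -/
lemma abs_integral_rsv_sub_empty_le [IsProbabilityMeasure μ] (hB : IsStandardOrthonormalBasis B)
    (hx : IsEnsemble x μ) {η : ℝ} (hη : 0 < η) (hη1 : η < 1) (hh : IsHypercontractive x μ 2 4 η)
    {d : ℕ} {Q : (Fin n → Fin (m ^ 2)) → ℝ}
    (hQ : ∀ σ, Q σ ≠ 0 → weight σ ≤ d) {τ : ℝ} (hτ : 0 < τ) (S : Finset (Fin n))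
    (hle : ∀ i ∈ S, ∑ σ, dependPart i Q σ ^ 2 ≤ τ) {y : ℝ} (hy : 0 < y) :
    |∫ ω, ntr (rsv (partialEval B ∅ Q (sample x ω)) y) ∂μ -
      ∫ ω, ntr (rsv (partialEval B S Q (sample x ω)) y) ∂μ| ≤
      2 * ((y ^ 4)⁻¹ * (max (9 * (m : ℝ)) (1 / η ^ 4) ^ d * √τ *
        ∑ i ∈ S, ∑ σ, dependPart i Q σ ^ 2)) := by
  induction S using Finset.induction_on with
  | empty => simp
  | insert i S hi ih =>
    have h1 := ih fun j hj => hle j (Finset.mem_insert_of_mem hj)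
    have h2 := abs_integral_rsv_sub_le hB hx hη hη1 hh hi hQ hτ
      (hle i (Finset.mem_insert_self i S)) hy
    rw [Finset.sum_insert hi]
    refine (abs_sub_le _ (∫ ω, ntr (rsv (partialEval B S Q (sample x ω)) y) ∂μ) _).trans
      ((add_le_add h1 h2).trans (le_of_eq (by ring)))

/-- Each `σ` is counted at most once for every nonzero entry, hence at most `d` times. -/
lemma sum_sum_dependPart_sq_le {k : ℕ} [NeZero k] (S : Finset (Fin n)) {d : ℕ}
    {Q : (Fin n → Fin k) → ℝ} (hQ : ∀ σ, Q σ ≠ 0 → weight σ ≤ d) :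
    ∑ i ∈ S, ∑ σ, dependPart i Q σ ^ 2 ≤
      d * ∑ σ ∈ Finset.univ.filter (fun σ : Fin n → Fin k => σ ≠ 0), Q σ ^ 2 := by
  rw [Finset.sum_comm, Finset.sum_filter, Finset.mul_sum]
  refine Finset.sum_le_sum fun σ _ => ?_
  have h1 : ∀ i, dependPart i Q σ ^ 2 = if σ i ≠ 0 then Q σ ^ 2 else 0 := by
    intro i
    by_cases h : σ i = 0 <;> simp [dependPart, h]
  simp only [h1]
  by_cases h0 : σ = 0
  · simp [h0]
  rw [if_pos h0]
  by_cases hq : Q σ = 0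
  · simp [hq]
  calc ∑ i ∈ S, (if σ i ≠ 0 then Q σ ^ 2 else 0)
      ≤ ∑ i, (if σ i ≠ 0 then Q σ ^ 2 else 0) :=
        Finset.sum_le_sum_of_subset_of_nonneg (Finset.subset_univ S) fun i _ _ => by
          split_ifs <;> positivity
    _ = weight σ * Q σ ^ 2 := by
        rw [← Finset.sum_filter, Finset.sum_const, nsmul_eq_mul, weight]
    _ ≤ d * Q σ ^ 2 := by
        refine mul_le_mul_of_nonneg_right ?_ (sq_nonneg _)
        exact_mod_cast hQ σ hq

end Lindeberg

/-! ### Traces in terms of eigenvalues. -/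

section Spectral

variable {κ : Type*} [Fintype κ] [DecidableEq κ] {M : Matrix κ κ ℂ}

/-- The matrix with the eigenvectors of `M` and the eigenvalues `w`. -/
def spectralMatrix (hM : M.IsHermitian) (w : κ → ℂ) : Matrix κ κ ℂ :=
  Unitary.conjStarAlgAut ℂ (Matrix κ κ ℂ) hM.eigenvectorUnitary (Matrix.diagonal w)

lemma spectralMatrix_eigenvalues (hM : M.IsHermitian) :
    spectralMatrix hM (fun k => (hM.eigenvalues k : ℂ)) = M :=
  hM.spectral_theorem.symm

lemma spectralMatrix_mul (hM : M.IsHermitian) (w u : κ → ℂ) :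
    spectralMatrix hM w * spectralMatrix hM u = spectralMatrix hM (fun k => w k * u k) := by
  rw [spectralMatrix, spectralMatrix, ← map_mul, Matrix.diagonal_mul_diagonal, spectralMatrix]

lemma spectralMatrix_one (hM : M.IsHermitian) : spectralMatrix hM (fun _ => 1) = 1 := by
  rw [spectralMatrix, Matrix.diagonal_one, map_one]

lemma spectralMatrix_sub_smul_one (hM : M.IsHermitian) (w : κ → ℂ) (c : ℂ) :
    spectralMatrix hM w - c • (1 : Matrix κ κ ℂ) = spectralMatrix hM (fun k => w k - c) := by
  rw [← spectralMatrix_one hM, spectralMatrix, spectralMatrix, spectralMatrix, ← map_smul,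
    ← map_sub]
  congr 1
  ext a b
  by_cases h : a = b <;> simp [h]

lemma ntr_spectralMatrix (hM : M.IsHermitian) (w : κ → ℂ) :
    ntr (spectralMatrix hM w) = (Fintype.card κ : ℝ)⁻¹ * ∑ k, (w k).re := by
  rw [spectralMatrix, Unitary.conjStarAlgAut_apply, ntr, Matrix.trace_mul_cycle,
    Unitary.coe_star_mul_self, one_mul, Matrix.trace_diagonal, Complex.re_sum]

lemma ntr_eq_sum_eigenvalues (hM : M.IsHermitian) :
    ntr M = (Fintype.card κ : ℝ)⁻¹ * ∑ k, hM.eigenvalues k := by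
  conv_lhs => rw [← spectralMatrix_eigenvalues hM, ntr_spectralMatrix]
  simp

lemma nsq_eq_sum_eigenvalues (hM : M.IsHermitian) :
    nsq M = (Fintype.card κ : ℝ)⁻¹ * ∑ k, hM.eigenvalues k ^ 2 := by
  rw [nsq_eq_of_isHermitian hM]
  conv_lhs => rw [← spectralMatrix_eigenvalues hM, spectralMatrix_mul, ntr_spectralMatrix]
  congr 1
  refine Finset.sum_congr rfl fun k _ => ?_
  rw [← Complex.ofReal_mul, Complex.ofReal_re, sq]

lemma nsq_mul_self_eq_sum_eigenvalues (hM : M.IsHermitian) :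
    nsq (M * M) = (Fintype.card κ : ℝ)⁻¹ * ∑ k, hM.eigenvalues k ^ 4 := by
  have hh : (M * M).IsHermitian := by
    rw [Matrix.IsHermitian, Matrix.conjTranspose_mul, hM.eq]
  rw [nsq_eq_of_isHermitian hh]
  conv_lhs => rw [← spectralMatrix_eigenvalues hM]
  rw [spectralMatrix_mul, spectralMatrix_mul, ntr_spectralMatrix]
  congr 1
  refine Finset.sum_congr rfl fun k _ => ?_
  rw [← Complex.ofReal_mul, ← Complex.ofReal_mul, Complex.ofReal_re]
  ring

lemma traceZeta_eq_sum_eigenvalues (hM : M.IsHermitian) :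
    traceZeta M = ∑ k, zeta (hM.eigenvalues k) := by
  rw [traceZeta, hM.cfc_eq, Matrix.IsHermitian.cfc, Unitary.conjStarAlgAut_apply,
    Matrix.trace_mul_cycle, Unitary.coe_star_mul_self, one_mul, Matrix.trace_diagonal,
    Complex.re_sum]
  rfl

lemma ntr_rsv_eq_sum_eigenvalues (hM : M.IsHermitian) {y : ℝ} (hy : y ≠ 0) :
    ntr (rsv M y) = (Fintype.card κ : ℝ)⁻¹ *
      ∑ k, hM.eigenvalues k / (hM.eigenvalues k ^ 2 + y ^ 2) := by
  have hne : ∀ t : ℝ, (t : ℂ) - (y : ℂ) * Complex.I ≠ 0 := by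
    intro t h
    have := congrArg Complex.im h
    simp at this
    exact hy this
  have h1 : rsv M y = spectralMatrix hM
      (fun k => ((hM.eigenvalues k : ℂ) - (y : ℂ) * Complex.I)⁻¹) := by
    refine Matrix.inv_eq_right_inv ?_
    conv_lhs => enter [1, 1]; rw [← spectralMatrix_eigenvalues hM]
    rw [spectralMatrix_sub_smul_one, spectralMatrix_mul]
    simp only [mul_inv_cancel₀ (hne _), spectralMatrix_one]
  rw [h1, ntr_spectralMatrix]
  congr 1
  refine Finset.sum_congr rfl fun k _ => ?_
  rw [Complex.inv_re]
  simp [Complex.normSq_apply, sq]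

end Spectral

/-! ### Integral representation of `ζ` through resolvents. -/

section IntegralRepresentation

lemma integrableOn_and_integral_inv_sq_add_sq {t : ℝ} (ht : 0 < t) :
    IntegrableOn (fun y : ℝ => (t ^ 2 + y ^ 2)⁻¹) (Set.Ioi 0) ∧
      ∫ y in Set.Ioi (0 : ℝ), (t ^ 2 + y ^ 2)⁻¹ = t⁻¹ * (Real.pi / 2) := by
  have e : (fun y : ℝ => (t ^ 2 + y ^ 2)⁻¹) = fun y => (t ^ 2)⁻¹ * (1 + (t⁻¹ * y) ^ 2)⁻¹ := by
    ext y
    rw [← mul_inv]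
    congr 1
    field_simp
  have hint : Integrable fun y : ℝ => (1 + (t⁻¹ * y) ^ 2)⁻¹ :=
    integrable_inv_one_add_sq.comp_mul_left' (inv_ne_zero ht.ne')
  rw [e]
  refine ⟨(hint.const_mul _).integrableOn, ?_⟩
  rw [integral_const_mul, integral_comp_mul_left_Ioi (fun y => (1 + y ^ 2)⁻¹) 0
    (inv_pos.mpr ht), mul_zero, integral_Ioi_inv_one_add_sq, Real.arctan_zero, sub_zero, inv_inv,
    smul_eq_mul]
  field_simp

lemma integrableOn_and_integral_pow_three_div (t : ℝ) :
    IntegrableOn (fun y : ℝ => t ^ 3 / (t ^ 2 + y ^ 2)) (Set.Ioi 0) ∧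
      ∫ y in Set.Ioi (0 : ℝ), t ^ 3 / (t ^ 2 + y ^ 2) = Real.pi / 2 * (t * |t|) := by
  rcases eq_or_ne t 0 with rfl | ht
  · simp
  · obtain ⟨h1, h2⟩ := integrableOn_and_integral_inv_sq_add_sq (abs_pos.mpr ht)
    simp only [sq_abs] at h1 h2
    simp only [div_eq_mul_inv]
    refine ⟨h1.const_mul _, ?_⟩
    rw [integral_const_mul, h2]
    have h3 : |t| ≠ 0 := abs_ne_zero.mpr ht
    have h4 : t ^ 3 = t * (|t| * |t|) := by rw [abs_mul_abs_self]; ring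
    rw [h4]
    field_simp

lemma zeta_eq (t : ℝ) : zeta t = (t ^ 2 - t * |t|) / 2 := by
  unfold zeta
  split_ifs with h
  · rw [abs_of_nonpos h]; ring
  · rw [abs_of_pos (not_le.mp h)]; ring

variable {κ : Type*} [Fintype κ] [DecidableEq κ] {M : Matrix κ κ ℂ}

/-- The normalized trace of `M³ / (M² + y²)`. -/
def cubicTrace (M : Matrix κ κ ℂ) (y : ℝ) : ℝ := ntr M - y ^ 2 * ntr (rsv M y)

lemma cubicTrace_eq (hM : M.IsHermitian) {y : ℝ} (hy : y ≠ 0) :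
    cubicTrace M y = (Fintype.card κ : ℝ)⁻¹ *
      ∑ k, hM.eigenvalues k ^ 3 / (hM.eigenvalues k ^ 2 + y ^ 2) := by
  rw [cubicTrace, ntr_rsv_eq_sum_eigenvalues hM hy, ntr_eq_sum_eigenvalues hM, mul_left_comm,
    ← mul_sub, Finset.mul_sum, ← Finset.sum_sub_distrib]
  congr 1
  refine Finset.sum_congr rfl fun k _ => ?_
  have : hM.eigenvalues k ^ 2 + y ^ 2 ≠ 0 := by positivity
  field_simp
  ring

/-- This is the dominating function for Fubini: integrable in `y`, with a random factor of finite
mean by the fourth moment bound. -/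
lemma abs_cubicTrace_le [Nonempty κ] (hM : M.IsHermitian) {y : ℝ} (hy : 0 < y) :
    |cubicTrace M y| ≤ (4 * (1 + nsq (M * M))) * (1 + y ^ 2)⁻¹ := by
  have hs : ∀ t : ℝ, |t ^ 3 / (t ^ 2 + y ^ 2)| ≤ (4 * (1 + t ^ 4)) * (1 + y ^ 2)⁻¹ := by
    intro t
    have h1 : 0 < t ^ 2 + y ^ 2 := by positivity
    rw [abs_div, abs_of_pos h1, ← div_eq_mul_inv, div_le_div_iff₀ h1 (by positivity), abs_pow]
    have ha := abs_nonneg t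
    rw [← sq_abs t, show t ^ 4 = |t| ^ 4 by rw [Even.pow_abs (by decide)]]
    generalize |t| = a at *
    have h2 : a ^ 3 ≤ 1 + a ^ 4 := by
      nlinarith [sq_nonneg (a ^ 2 - a), sq_nonneg (a ^ 2 - 1), sq_nonneg (a - 1), sq_nonneg a]
    have h3 : a ^ 3 ≤ (1 + a ^ 4) * a ^ 2 := by
      have : a ≤ 1 + a ^ 4 := by
        nlinarith [sq_nonneg (a ^ 2 - 1), sq_nonneg (a - 1), sq_nonneg (a ^ 2)]
      nlinarith [mul_le_mul_of_nonneg_right this (sq_nonneg a)]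
    have h4 : 0 ≤ (1 + a ^ 4) * a ^ 2 := by positivity
    have h5 : a ^ 3 * y ^ 2 ≤ (1 + a ^ 4) * y ^ 2 := mul_le_mul_of_nonneg_right h2 (sq_nonneg y)
    have h6 : 0 ≤ (1 + a ^ 4) * y ^ 2 := by positivity
    nlinarith
  have hN : (Fintype.card κ : ℝ) ≠ 0 := Nat.cast_ne_zero.mpr Fintype.card_ne_zero
  rw [cubicTrace_eq hM hy.ne', abs_mul, abs_of_nonneg (by positivity)]
  calc (Fintype.card κ : ℝ)⁻¹ *
        |∑ k, hM.eigenvalues k ^ 3 / (hM.eigenvalues k ^ 2 + y ^ 2)|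
      ≤ (Fintype.card κ : ℝ)⁻¹ * ∑ k, (4 * (1 + hM.eigenvalues k ^ 4)) * (1 + y ^ 2)⁻¹ := by
        refine mul_le_mul_of_nonneg_left ?_ (by positivity)
        exact (Finset.abs_sum_le_sum_abs _ _).trans (Finset.sum_le_sum fun k _ => hs _)
    _ = _ := by
        rw [nsq_mul_self_eq_sum_eigenvalues hM, ← Finset.sum_mul, ← Finset.mul_sum,
          Finset.sum_add_distrib]
        simp only [Finset.sum_const, Finset.card_univ, nsmul_eq_mul, mul_one]
        field_simp

/-- The integral representation of the normalized trace of `ζ(M)`. -/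
lemma traceZeta_eq_integral (hM : M.IsHermitian) :
    (Fintype.card κ : ℝ)⁻¹ * traceZeta M =
      nsq M / 2 - Real.pi⁻¹ * ∫ y in Set.Ioi (0 : ℝ), cubicTrace M y := by
  have h1 : ∫ y in Set.Ioi (0 : ℝ), cubicTrace M y = (Fintype.card κ : ℝ)⁻¹ *
      ∑ k, Real.pi / 2 * (hM.eigenvalues k * |hM.eigenvalues k|) := by
    rw [setIntegral_congr_fun measurableSet_Ioi fun y hy => cubicTrace_eq hM (ne_of_gt hy),
      integral_const_mul, integral_finsetSum _ fun k _ =>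
        (integrableOn_and_integral_pow_three_div (hM.eigenvalues k)).1]
    simp only [(integrableOn_and_integral_pow_three_div _).2]
  rw [h1, traceZeta_eq_sum_eigenvalues hM, nsq_eq_sum_eigenvalues hM, ← Finset.mul_sum]
  simp only [zeta_eq]
  rw [← Finset.sum_div, Finset.sum_sub_distrib]
  have := Real.pi_ne_zero
  field_simp

end IntegralRepresentation

/-- Cut at `l = ε^(1/3)`: the part below contributes at most `2l · l`, the tail `ε / l = l²`. -/
lemma abs_integral_Ioi_le_of_le_of_le {f : ℝ → ℝ} {ε : ℝ} (hε : 0 < ε)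
    (hf : IntegrableOn f (Set.Ioi 0)) (h1 : ∀ y, 0 < y → |f y| ≤ 2 * y)
    (h2 : ∀ y, 0 < y → |f y| ≤ ε * (y ^ 2)⁻¹) :
    |∫ y in Set.Ioi (0 : ℝ), f y| ≤ 3 * ε ^ ((2 : ℝ) / 3) := by
  set l := ε ^ ((1 : ℝ) / 3) with hl
  have hl0 : 0 < l := Real.rpow_pos_of_pos hε _
  have hl2 : l ^ 2 = ε ^ ((2 : ℝ) / 3) := by
    rw [hl, ← Real.rpow_natCast, ← Real.rpow_mul hε.le]; norm_num
  have hl3 : l ^ 3 = ε := by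
    rw [hl, ← Real.rpow_natCast, ← Real.rpow_mul hε.le]; norm_num
  rw [← Set.Ioc_union_Ioi_eq_Ioi hl0.le, setIntegral_union (Set.Ioc_disjoint_Ioi le_rfl)
    measurableSet_Ioi (hf.mono_set Set.Ioc_subset_Ioi_self)
    (hf.mono_set (Set.Ioi_subset_Ioi hl0.le))]
  have b1 : |∫ y in Set.Ioc 0 l, f y| ≤ 2 * l ^ 2 := by
    have := norm_setIntegral_le_of_norm_le_const (μ := volume) (s := Set.Ioc 0 l) (f := f)
      (C := 2 * l) (by simp) fun y hy => (h1 y hy.1).trans (by linarith [hy.2])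
    rw [Real.norm_eq_abs] at this
    refine this.trans (le_of_eq ?_)
    simp [Measure.real, hl0.le]
    ring
  have e : ∀ y ∈ Set.Ioi l, ε * (y ^ 2)⁻¹ = ε * y ^ (-2 : ℝ) := by
    intro y hy
    have hy0 : 0 < y := hl0.trans hy
    rw [Real.rpow_neg hy0.le]
    norm_cast
  have i2 : IntegrableOn (fun y : ℝ => ε * (y ^ 2)⁻¹) (Set.Ioi l) := by
    rw [integrableOn_congr_fun e measurableSet_Ioi]
    exact (integrableOn_Ioi_rpow_of_lt (by norm_num) hl0).const_mul ε
  have b2 : |∫ y in Set.Ioi l, f y| ≤ l ^ 2 := by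
    rw [← Real.norm_eq_abs]
    refine (norm_integral_le_of_norm_le i2 ?_).trans (le_of_eq ?_)
    · filter_upwards [ae_restrict_mem measurableSet_Ioi] with y hy
      exact h2 y (hl0.trans hy)
    · rw [setIntegral_congr_fun measurableSet_Ioi e, integral_const_mul,
        integral_Ioi_rpow_of_lt (by norm_num) hl0, ← hl3]
      norm_num
      rw [Real.rpow_neg_one]
      field_simp
  rw [← hl2]
  exact (abs_add_le _ _).trans (by linarith)

lemma measurable_cubicTrace {κ : Type*} [Fintype κ] [DecidableEq κ] {α : Type*}
    [TopologicalSpace α] [MeasurableSpace α] [OpensMeasurableSpace α] {f : α → Matrix κ κ ℂ}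
    (hf : Continuous f) {g : α → ℝ} (hg : Continuous g) :
    Measurable fun a => cubicTrace (f a) (g a) := by
  have h1 : Measurable fun a => ntr (f a) := (continuous_ntr.comp hf).measurable
  have h2 : Measurable fun a => g a ^ 2 * ntr (rsv (f a) (g a)) :=
    (hg.measurable.pow_const 2).mul (measurable_ntr_rsv hf hg)
  exact h1.sub h2

/-! ### Invariance principle for hybrids. -/

section

variable {m n : ℕ} [NeZero m] {B : Fin (m ^ 2) → Matrix (Fin m) (Fin m) ℂ}
  {Ω : Type*} [MeasurableSpace Ω] {μ : Measure Ω} [IsProbabilityMeasure μ]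
  {x : Fin n → Fin (m ^ 2) → Ω → ℝ}

lemma integrable_cubicTrace_prod (hB : IsStandardOrthonormalBasis B)
    (hx : IsEnsemble x μ) {η : ℝ} (hη : 0 < η) (hη1 : η < 1) (hh : IsHypercontractive x μ 2 4 η)
    (S : Finset (Fin n)) {d : ℕ} {Q : (Fin n → Fin (m ^ 2)) → ℝ}
    (hQ : ∀ σ, Q σ ≠ 0 → weight σ ≤ d) :
    Integrable (fun p : Ω × ℝ => cubicTrace (partialEval B S Q (sample x p.1)) p.2)
      (μ.prod (volume.restrict (Set.Ioi 0))) := by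
  have hc : Continuous fun p : (Fin n → Fin (m ^ 2) → ℝ) × ℝ => partialEval B S Q p.1 :=
    (continuous_partialEval S Q).comp continuous_fst
  have hm : Measurable fun p : (Fin n → Fin (m ^ 2) → ℝ) × ℝ =>
      cubicTrace (partialEval B S Q p.1) p.2 := measurable_cubicTrace hc continuous_snd
  have hpair : Measurable fun p : Ω × ℝ => (sample x p.1, p.2) :=
    (hx.measurable_sample.comp measurable_fst).prodMk measurable_snd
  have hcomp : ∀ F : (Fin n → Fin (m ^ 2) → ℝ) → ℝ → ℝ, (Measurable fun p :
      (Fin n → Fin (m ^ 2) → ℝ) × ℝ => F p.1 p.2) →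
      Measurable fun p : Ω × ℝ => F (sample x p.1) p.2 := fun F hF => hF.comp hpair
  have hm2 := hcomp (fun v y => cubicTrace (partialEval B S Q v) y) hm
  have h4 : Integrable (fun ω => 4 * (1 + nsq (partialEval B S Q (sample x ω) *
      partialEval B S Q (sample x ω)))) μ :=
    ((integrable_const (1 : ℝ)).add
      (integral_nsq_partialEval_mul_self_le hB hx hη hη1 hh S hQ).1).const_mul 4
  have h5 : Integrable (fun y : ℝ => (1 + y ^ 2)⁻¹) (volume.restrict (Set.Ioi (0 : ℝ))) :=
    integrable_inv_one_add_sq.integrableOn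
  refine (h4.mul_prod h5).mono' hm2.aestronglyMeasurable ?_
  have hae : ∀ᵐ p ∂(μ.prod (volume.restrict (Set.Ioi (0 : ℝ)))), p.2 ∈ Set.Ioi (0 : ℝ) :=
    Measure.quasiMeasurePreserving_snd.ae (ae_restrict_mem measurableSet_Ioi)
  filter_upwards [hae] with p hp
  exact abs_cubicTrace_le (partialEval_isHermitian hB _ _ _) hp

lemma integral_cubicTrace (hB : IsStandardOrthonormalBasis B)
    (hx : IsEnsemble x μ) (S : Finset (Fin n)) (Q : (Fin n → Fin (m ^ 2)) → ℝ) {y : ℝ}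
    (hy : 0 < y) :
    ∫ ω, cubicTrace (partialEval B S Q (sample x ω)) y ∂μ =
      Q 0 - y ^ 2 * ∫ ω, ntr (rsv (partialEval B S Q (sample x ω)) y) ∂μ := by
  unfold cubicTrace
  rw [integral_sub (integrable_ntr_partialEval hB hx S Q)
    ((integrable_ntr_rsv_partialEval hB hx S Q hy).const_mul _),
    integral_ntr_partialEval hB hx, integral_const_mul]

lemma integral_traceZeta_partialEval (hB : IsStandardOrthonormalBasis B)
    (hx : IsEnsemble x μ) {η : ℝ} (hη : 0 < η) (hη1 : η < 1) (hh : IsHypercontractive x μ 2 4 η)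
    (S : Finset (Fin n)) {d : ℕ} {Q : (Fin n → Fin (m ^ 2)) → ℝ}
    (hQ : ∀ σ, Q σ ≠ 0 → weight σ ≤ d) :
    Integrable (fun ω => (Fintype.card (Fin n → Fin m) : ℝ)⁻¹ *
      traceZeta (partialEval B S Q (sample x ω))) μ ∧
    ∫ ω, (Fintype.card (Fin n → Fin m) : ℝ)⁻¹ * traceZeta (partialEval B S Q (sample x ω)) ∂μ =
      (∑ σ, Q σ ^ 2) / 2 - Real.pi⁻¹ * ∫ y in Set.Ioi (0 : ℝ),
        ∫ ω, cubicTrace (partialEval B S Q (sample x ω)) y ∂μ := by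
  have hint := integrable_cubicTrace_prod hB hx hη hη1 hh S hQ
  have h2 := integrable_nsq_partialEval hB hx S Q
  have h3 : Integrable (fun ω => ∫ y in Set.Ioi (0 : ℝ),
      cubicTrace (partialEval B S Q (sample x ω)) y) μ := hint.integral_prod_left
  simp only [traceZeta_eq_integral (partialEval_isHermitian hB _ _ _)]
  refine ⟨(h2.div_const 2).sub (h3.const_mul _), ?_⟩
  rw [integral_sub (h2.div_const 2) (h3.const_mul _), integral_div, integral_const_mul,
    integral_nsq_partialEval hB hx, integral_integral_swap hint]

/-- The invariance principle for partial evaluations. -/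
lemma abs_integral_traceZeta_sub_le (hB : IsStandardOrthonormalBasis B)
    (hx : IsEnsemble x μ) {η : ℝ} (hη : 0 < η) (hη1 : η < 1) (hh : IsHypercontractive x μ 2 4 η)
    {d : ℕ} (hd : 0 < d) {Q : (Fin n → Fin (m ^ 2)) → ℝ}
    (hQ : ∀ σ, Q σ ≠ 0 → weight σ ≤ d) {τ : ℝ} (hτ : 0 < τ) (S : Finset (Fin n))
    (hle : ∀ i ∈ S, ∑ σ, dependPart i Q σ ^ 2 ≤ τ)
    (hvar : ∑ σ ∈ Finset.univ.filter (fun σ : Fin n → Fin (m ^ 2) => σ ≠ 0), Q σ ^ 2 ≤ 1) :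
    |∫ ω, (Fintype.card (Fin n → Fin m) : ℝ)⁻¹ *
        traceZeta (partialEval B ∅ Q (sample x ω)) ∂μ -
      ∫ ω, (Fintype.card (Fin n → Fin m) : ℝ)⁻¹ *
        traceZeta (partialEval B S Q (sample x ω)) ∂μ| ≤
      3 * (2 * max (9 * (m : ℝ)) (1 / η ^ 4) ^ d * √τ * d) ^ ((2 : ℝ) / 3) := by
  rw [(integral_traceZeta_partialEval hB hx hη hη1 hh ∅ hQ).2,
    (integral_traceZeta_partialEval hB hx hη hη1 hh S hQ).2]
  set K := max (9 * (m : ℝ)) (1 / η ^ 4) with hK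
  have hK0 : 0 < K := lt_of_lt_of_le (by positivity) (le_max_right _ _)
  have hsτ : 0 < √τ := Real.sqrt_pos.mpr hτ
  have hd0 : (0 : ℝ) < d := Nat.cast_pos.mpr hd
  set ε := 2 * K ^ d * √τ * d with hε
  have hε0 : 0 < ε := by positivity
  set f := fun (T : Finset (Fin n)) (y : ℝ) =>
    ∫ ω, cubicTrace (partialEval B T Q (sample x ω)) y ∂μ with hf
  have hfi : ∀ T, IntegrableOn (f T) (Set.Ioi 0) := fun T =>
    (integrable_cubicTrace_prod hB hx hη hη1 hh T hQ).integral_prod_right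
  have e : ∀ a b c p : ℝ, (a - p * b) - (a - p * c) = p * (c - b) := fun a b c p => by ring
  rw [e, ← integral_sub (hfi S) (hfi ∅), abs_mul, abs_of_pos (inv_pos.mpr Real.pi_pos)]
  have hdiff : ∀ y, 0 < y → f S y - f ∅ y =
      y ^ 2 * (∫ ω, ntr (rsv (partialEval B ∅ Q (sample x ω)) y) ∂μ -
        ∫ ω, ntr (rsv (partialEval B S Q (sample x ω)) y) ∂μ) := by
    intro y hy
    simp only [hf, integral_cubicTrace hB hx _ _ hy]
    ring
  have hbd : ∀ (T : Finset (Fin n)) (y : ℝ), 0 < y →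
      |∫ ω, ntr (rsv (partialEval B T Q (sample x ω)) y) ∂μ| ≤ y⁻¹ := by
    intro T y hy
    have := norm_integral_le_of_norm_le (μ := μ)
      (f := fun ω => ntr (rsv (partialEval B T Q (sample x ω)) y)) (integrable_const y⁻¹)
      (Filter.Eventually.of_forall fun ω =>
        abs_ntr_rsv_le (partialEval_isHermitian hB T Q (sample x ω)) hy)
    simpa using this
  have hmain := abs_integral_Ioi_le_of_le_of_le (f := fun y => f S y - f ∅ y) hε0
    ((hfi S).sub (hfi ∅)) (fun y hy => ?_) (fun y hy => ?_)
  -- The factor `1/π` of the integral representation is simply bounded by `1`.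
  · have hpi : Real.pi⁻¹ ≤ 1 := inv_le_one_of_one_le₀ (by linarith [Real.pi_gt_three])
    exact (mul_le_of_le_one_left (abs_nonneg _) hpi).trans hmain
  · rw [hdiff y hy, abs_mul, abs_of_pos (by positivity : (0 : ℝ) < y ^ 2)]
    have h1 := (abs_sub _ _).trans (add_le_add (hbd ∅ y hy) (hbd S y hy))
    refine (mul_le_mul_of_nonneg_left h1 (by positivity)).trans (le_of_eq ?_)
    field_simp
    ring
  · rw [hdiff y hy, abs_mul, abs_of_pos (by positivity : (0 : ℝ) < y ^ 2)]
    have h1 := abs_integral_rsv_sub_empty_le hB hx hη hη1 hh hQ hτ S hle hy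
    have h2 : ∑ i ∈ S, ∑ σ, dependPart i Q σ ^ 2 ≤ d :=
      (sum_sum_dependPart_sq_le S hQ).trans (mul_le_of_le_one_right hd0.le hvar)
    have h3 : 2 * ((y ^ 4)⁻¹ * (K ^ d * √τ * ∑ i ∈ S, ∑ σ, dependPart i Q σ ^ 2)) ≤
        2 * ((y ^ 4)⁻¹ * (K ^ d * √τ * d)) := by gcongr
    refine (mul_le_mul_of_nonneg_left (h1.trans h3) (by positivity)).trans (le_of_eq ?_)
    rw [hε]
    field_simp

end

/-! ### Tensoring with the identity outside `H`, so that all hybrids act on one space. -/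

open Kronecker in
/-- The operator on all registers that acts as `X` on the registers of `H` and as the identity on
the others. -/
def lift {m n : ℕ} (H : Finset (Fin n)) (X : Matrix (H → Fin m) (H → Fin m) ℂ) :
    Matrix (Fin n → Fin m) (Fin n → Fin m) ℂ :=
  (X ⊗ₖ (1 : Matrix ({i // i ∉ H} → Fin m) ({i // i ∉ H} → Fin m) ℂ)).submatrix
    (Equiv.piEquivPiSubtypeProd (· ∈ H) fun _ => Fin m)
    (Equiv.piEquivPiSubtypeProd (· ∈ H) fun _ => Fin m)

section Lift

variable {m n : ℕ} (H : Finset (Fin n))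

lemma lift_apply (X : Matrix (H → Fin m) (H → Fin m) ℂ) (a b : Fin n → Fin m) :
    lift H X a b = X (fun i => a i) (fun i => b i) *
      (1 : Matrix ({i // i ∉ H} → Fin m) ({i // i ∉ H} → Fin m) ℂ)
        (fun i => a i) (fun i => b i) := rfl

lemma lift_mul (X Y : Matrix (H → Fin m) (H → Fin m) ℂ) :
    lift H (X * Y) = lift H X * lift H Y := by
  rw [lift, lift, lift, Matrix.submatrix_mul_equiv, ← Matrix.mul_kronecker_mul, mul_one]

lemma lift_one : lift H (1 : Matrix (H → Fin m) (H → Fin m) ℂ) = 1 := by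
  rw [lift, Matrix.one_kronecker_one, Matrix.submatrix_one_equiv]

lemma lift_sub (X Y : Matrix (H → Fin m) (H → Fin m) ℂ) :
    lift H (X - Y) = lift H X - lift H Y := by
  ext a b
  simp [lift_apply, sub_mul]

lemma lift_smul (c : ℂ) (X : Matrix (H → Fin m) (H → Fin m) ℂ) :
    lift H (c • X) = c • lift H X := by
  ext a b
  simp [lift_apply, mul_assoc]

lemma lift_sum {ι : Type*} (s : Finset ι) (X : ι → Matrix (H → Fin m) (H → Fin m) ℂ) :
    lift H (∑ k ∈ s, X k) = ∑ k ∈ s, lift H (X k) := by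
  ext a b
  simp [lift_apply, Matrix.sum_apply, Finset.sum_mul]

lemma lift_conjTranspose (X : Matrix (H → Fin m) (H → Fin m) ℂ) :
    lift H Xᴴ = (lift H X)ᴴ := by
  ext a b
  simp only [lift_apply, Matrix.conjTranspose_apply, star_mul', Matrix.one_apply]
  congr 1
  split_ifs <;> simp_all

lemma ntr_lift [NeZero m] (X : Matrix (H → Fin m) (H → Fin m) ℂ) : ntr (lift H X) = ntr X := by
  have h1 : Matrix.trace (lift H X) =
      Matrix.trace X * (Fintype.card ({i // i ∉ H} → Fin m) : ℂ) := by
    rw [← Matrix.trace_one, ← Matrix.trace_kronecker, lift]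
    exact Fintype.sum_equiv (Equiv.piEquivPiSubtypeProd (· ∈ H) fun _ => Fin m) _ _ fun _ => rfl
  have h2 : Fintype.card (Fin n → Fin m) =
      Fintype.card (H → Fin m) * Fintype.card ({i // i ∉ H} → Fin m) := by
    rw [← Fintype.card_prod]
    exact Fintype.card_congr (Equiv.piEquivPiSubtypeProd (· ∈ H) fun _ => Fin m)
  have h3 : (Fintype.card ({i // i ∉ H} → Fin m) : ℝ) ≠ 0 :=
    Nat.cast_ne_zero.mpr Fintype.card_ne_zero
  rw [ntr, ntr, h1, h2, ← Complex.ofReal_natCast, Complex.re_mul_ofReal, Nat.cast_mul]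
  field_simp

lemma nsq_lift [NeZero m] (X : Matrix (H → Fin m) (H → Fin m) ℂ) : nsq (lift H X) = nsq X := by
  rw [nsq, ← lift_conjTranspose, ← lift_mul, ntr_lift, nsq]

lemma rsv_lift {X : Matrix (H → Fin m) (H → Fin m) ℂ} (hX : X.IsHermitian) {y : ℝ} (hy : y ≠ 0) :
    rsv (lift H X) y = lift H (rsv X y) := by
  refine Matrix.inv_eq_right_inv ?_
  rw [← lift_one H, ← lift_smul, ← lift_sub, ← lift_mul, sub_mul_rsv hX hy]

/-- The integral representation reduces the claim to the second moment, the trace and the resolvent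
traces, all unchanged by `lift`; eigenvalue multiplicities need not be tracked. -/
lemma traceZeta_lift [NeZero m] {X : Matrix (H → Fin m) (H → Fin m) ℂ} (hX : X.IsHermitian) :
    (Fintype.card (Fin n → Fin m) : ℝ)⁻¹ * traceZeta (lift H X) =
      (Fintype.card (H → Fin m) : ℝ)⁻¹ * traceZeta X := by
  have hL : (lift H X).IsHermitian := by
    rw [Matrix.IsHermitian, ← lift_conjTranspose, hX.eq]
  rw [traceZeta_eq_integral hX, traceZeta_eq_integral hL, nsq_lift]
  congr 2
  refine setIntegral_congr_fun measurableSet_Ioi fun y hy => ?_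
  simp only [cubicTrace]
  rw [rsv_lift H hX (ne_of_gt hy), ntr_lift, ntr_lift]

end Lift

/-! ### From operators, influence and degree to Fourier coefficients. -/

section Translation

variable {m n : ℕ} [NeZero m] {B : Fin (m ^ 2) → Matrix (Fin m) (Fin m) ℂ}

lemma lift_tensorBasis (hB : IsStandardOrthonormalBasis B) (H : Finset (Fin n))
    (σ : Fin n → Fin (m ^ 2)) :
    lift H (tensorBasis B fun i : H => σ i) = tensorBasis B (Hᶜ.piecewise 0 σ) := by
  ext a b
  rw [lift_apply, ← tens_one, tens_apply, tensorBasis_eq_tens, tensorBasis_eq_tens, tens_apply,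
    tens_apply, ← Fintype.prod_subtype_mul_prod_subtype (· ∈ H)]
  congr 1
  · refine Finset.prod_congr (by ext; simp) fun i _ => ?_
    have : (i : Fin n) ∉ Hᶜ := by simp [i.2]
    rw [Finset.piecewise_eq_of_notMem _ _ _ this]
  · refine Finset.prod_congr rfl fun i _ => ?_
    have : (i : Fin n) ∈ Hᶜ := by simp [i.2]
    rw [Finset.piecewise_eq_of_mem _ _ _ this, Pi.zero_apply, hB.zero_eq_one]

lemma randomSubst_isHermitian {Ω : Type*} (hB : IsStandardOrthonormalBasis B) (H : Finset (Fin n))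
    (P : Matrix (Fin n → Fin m) (Fin n → Fin m) ℂ) (x : Fin n → Fin (m ^ 2) → Ω → ℝ) (ω : Ω) :
    (randomSubst B H P x ω).IsHermitian := by
  rw [Matrix.IsHermitian, randomSubst, Matrix.conjTranspose_sum]
  refine Finset.sum_congr rfl fun σ _ => ?_
  rw [Matrix.conjTranspose_smul, (tensorBasis_isHermitian hB _).eq]
  congr 1
  exact Complex.conj_ofReal _

lemma lift_randomSubst {Ω : Type*} (hB : IsStandardOrthonormalBasis B) (H : Finset (Fin n))
    (P : Matrix (Fin n → Fin m) (Fin n → Fin m) ℂ) (x : Fin n → Fin (m ^ 2) → Ω → ℝ) (ω : Ω) :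
    lift H (randomSubst B H P x ω) = partialEval B Hᶜ (fourierCoeff B P) (sample x ω) := by
  rw [randomSubst, lift_sum, partialEval]
  refine Finset.sum_congr rfl fun σ _ => ?_
  rw [lift_smul, lift_tensorBasis hB, Complex.coe_smul]
  rfl

lemma partialEval_empty_fourierCoeff (hB : IsStandardOrthonormalBasis B)
    {P : Matrix (Fin n → Fin m) (Fin n → Fin m) ℂ} (hP : P.IsHermitian)
    (v : Fin n → Fin (m ^ 2) → ℝ) : partialEval B ∅ (fourierCoeff B P) v = P := by
  conv_rhs => rw [← sum_fourierCoeff_smul_tensorBasis hB hP]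
  simp [partialEval]

lemma averageOut_tensorBasis (hB : IsStandardOrthonormalBasis B) (i : Fin n)
    (σ : Fin n → Fin (m ^ 2)) :
    averageOut i (tensorBasis B σ) = if σ i = 0 then tensorBasis B σ else 0 := by
  have hm : (m : ℂ) ≠ 0 := Nat.cast_ne_zero.mpr (NeZero.ne m)
  ext a b
  have h1 : ∀ c, tensorBasis B σ (Function.update a i c) (Function.update b i c) =
      B (σ i) c c * ∏ k ∈ Finset.univ.erase i, B (σ k) (a k) (b k) := by
    intro c
    rw [tensorBasis_eq_tens, tens_apply, ← Finset.mul_prod_erase _ _ (Finset.mem_univ i)]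
    congr 1
    · simp
    · refine Finset.prod_congr rfl fun k hk => ?_
      rw [Function.update_of_ne (Finset.ne_of_mem_erase hk),
        Function.update_of_ne (Finset.ne_of_mem_erase hk)]
  have h2 : ∑ c, B (σ i) c c = if σ i = 0 then (m : ℂ) else 0 := by
    have := hB.trace_mul (σ i) 0
    rwa [hB.zero_eq_one, mul_one] at this
  have h3 : tensorBasis B σ a b = B (σ i) (a i) (b i) *
      ∏ k ∈ Finset.univ.erase i, B (σ k) (a k) (b k) := by
    rw [tensorBasis_eq_tens, tens_apply, ← Finset.mul_prod_erase _ _ (Finset.mem_univ i)]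
  rw [averageOut, Matrix.of_apply]
  simp only [h1, ← Finset.sum_mul, h2]
  by_cases h : σ i = 0
  · rw [if_pos h, if_pos h, h3, h, hB.zero_eq_one, Matrix.one_apply]
    split_ifs
    · rw [← mul_assoc, inv_mul_cancel₀ hm]
    · rw [zero_mul]
  · simp [h]

lemma averageOut_sum_smul {m : ℕ} (i : Fin n) (Q : (Fin n → Fin (m ^ 2)) → ℝ)
    (X : (Fin n → Fin (m ^ 2)) → Matrix (Fin n → Fin m) (Fin n → Fin m) ℂ) :
    averageOut i (∑ σ, Q σ • X σ) = ∑ σ, Q σ • averageOut i (X σ) := by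
  ext a b
  simp only [averageOut, Matrix.sum_apply, Matrix.smul_apply, Matrix.of_apply]
  split_ifs
  · rw [Finset.sum_comm, Finset.mul_sum]
    refine Finset.sum_congr rfl fun σ _ => ?_
    rw [← Finset.smul_sum, mul_smul_comm]
  · simp

/-- `averageOut i` fixes the basis elements with index `0` at `i` and kills the others; Parseval
does the rest. -/
lemma influence_eq_sum_dependPart (hB : IsStandardOrthonormalBasis B)
    {P : Matrix (Fin n → Fin m) (Fin n → Fin m) ℂ} (hP : P.IsHermitian) (i : Fin n) :
    influence i P = ∑ σ, dependPart i (fourierCoeff B P) σ ^ 2 := by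
  have h1 : P - averageOut i P = partialEval B ∅ (dependPart i (fourierCoeff B P)) 0 := by
    conv_lhs => rw [← sum_fourierCoeff_smul_tensorBasis hB hP]
    rw [averageOut_sum_smul, ← Finset.sum_sub_distrib, partialEval]
    refine Finset.sum_congr rfl fun σ _ => ?_
    rw [averageOut_tensorBasis hB]
    by_cases h : σ i = 0 <;> simp [h, dependPart]
  rw [influence, h1, ← nsq_partialEval_empty hB _ 0, nsq, ntr, normInner]
  rw [← Complex.ofReal_natCast, ← Complex.ofReal_inv, Complex.re_ofReal_mul]

lemma weight_le_of_degree_le {P : Matrix (Fin n → Fin m) (Fin n → Fin m) ℂ} {d : ℕ}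
    (h : degree B P ≤ d) (σ : Fin n → Fin (m ^ 2)) (hσ : fourierCoeff B P σ ≠ 0) :
    weight σ ≤ d :=
  (Finset.le_sup (f := weight) (by simpa using hσ)).trans h

end Translation

end MatrixInvariance

end

theorem mainTheorem11 :
    ∃ C B₃ : ℝ, 0 < C ∧ 0 < B₃ ∧
      ∀ (τ η : ℝ) (d h m n : ℕ) [NeZero m]
        (B : Fin (m ^ 2) → Matrix (Fin m) (Fin m) ℂ) (H : Finset (Fin n))
        (Ω : Type*) [MeasurableSpace Ω] (μ : Measure Ω) [IsProbabilityMeasure μ]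
        (x : Fin n → Fin (m ^ 2) → Ω → ℝ)
        (P : Matrix (Fin n → Fin m) (Fin n → Fin m) ℂ),
        0 < τ → τ < 1 → 0 < η → η < 1 → 0 < d → 0 < h → 0 < n → H.card = h →
        MatrixInvariance.IsStandardOrthonormalBasis B →
        MatrixInvariance.IsEnsemble x μ →
        MatrixInvariance.IsHypercontractive x μ 2 4 η →
        P.IsHermitian →
        MatrixInvariance.degree B P ≤ d →
        (∀ i, i ∉ H → MatrixInvariance.influence i P ≤ τ) →
        ∑ σ ∈ Finset.univ.filter (fun σ : Fin n → Fin (m ^ 2) => σ ≠ 0),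
          MatrixInvariance.fourierCoeff B P σ ^ 2 ≤ 1 →
        Integrable (fun ω => MatrixInvariance.traceZeta (MatrixInvariance.randomSubst B H P x ω)) μ ∧
        |((m : ℝ) ^ n)⁻¹ * MatrixInvariance.traceZeta P -
            ((m : ℝ) ^ h)⁻¹ *
              ∫ ω, MatrixInvariance.traceZeta (MatrixInvariance.randomSubst B H P x ω) ∂μ|
          ≤ 3 * (C * B₃ * max (9 * (m : ℝ)) (1 / η ^ 4) ^ d * √τ * d) ^ ((2 : ℝ) / 3) := by
  -- The `2` counts the two third order remainders of a replacement step. Only the product of the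
  -- two constants matters.
  refine ⟨2, 1, by norm_num, by norm_num, ?_⟩
  intro τ η d h m n _ B H Ω _ μ _ x P hτ _ hη hη1 hd _ _ hH hB hx hh hP hdeg hinf hvar
  have hQ := MatrixInvariance.weight_le_of_degree_le hdeg
  have hcard : (Fintype.card (H → Fin m) : ℝ) = (m : ℝ) ^ h := by simp [hH]
  have hcardn : (Fintype.card (Fin n → Fin m) : ℝ) = (m : ℝ) ^ n := by simp
  have hm : (m : ℝ) ^ h ≠ 0 := pow_ne_zero _ (Nat.cast_ne_zero.mpr (NeZero.ne m))
  have e1 : ∀ ω, (Fintype.card (Fin n → Fin m) : ℝ)⁻¹ * MatrixInvariance.traceZeta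
      (MatrixInvariance.partialEval B Hᶜ (MatrixInvariance.fourierCoeff B P)
        (MatrixInvariance.sample x ω)) =
      ((m : ℝ) ^ h)⁻¹ * MatrixInvariance.traceZeta (MatrixInvariance.randomSubst B H P x ω) := by
    intro ω
    rw [← MatrixInvariance.lift_randomSubst hB, MatrixInvariance.traceZeta_lift H
      (MatrixInvariance.randomSubst_isHermitian hB H P x ω), hcard]
  have hmain := MatrixInvariance.abs_integral_traceZeta_sub_le hB hx hη hη1 hh hd hQ hτ Hᶜ
    (fun i hi => by
      rw [← MatrixInvariance.influence_eq_sum_dependPart hB hP]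
      exact hinf i (by simpa using hi)) hvar
  have hint := (MatrixInvariance.integral_traceZeta_partialEval hB hx hη hη1 hh Hᶜ hQ).1
  simp only [e1] at hint hmain
  constructor
  · have := hint.const_mul ((m : ℝ) ^ h)
    simpa only [mul_inv_cancel_left₀ hm] using this
  · rw [mul_one]
    -- With nothing substituted the hybrid is the constant `P`, so its expectation under a
    -- probability measure is the deterministic term.
    simpa [MatrixInvariance.partialEval_empty_fourierCoeff hB hP, integral_const_mul] using hmain
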